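/- Let $M$ be a complex manifold with complex structure $\mathcal J$ and a holomorphic symplectic form $\omega$, and let $c=\omega^{-1}$ be the inverse holomorphic Poisson bivector. Let $J$ be the real bihamiltonian structure on $M$ spanned by $c_1=\operatorname{Re}c$ and $c_2=\operatorname{Im}c$. Let $p:M\to M'$ be a smooth surjective submersion with connected fibres onto a real smooth manifold $M'$, and let $\mathcal K$ be the foliation of $M$ by the fibres of $p$. Assume that $\mathcal K$ is a generic $CR$-foliation: $\dim T_x^{1,0}\mathcal K$ is constant along each leaf and $T_x\mathcal K+\mathcal J\,T_x\mathcal K=T_xM$ for all $x$, where $T^{1,0}_xL=(T_xL\otimes\mathbb C)\cap T^{1,0}_xM$ for a submanifold $L$. A bihamiltonian structure on $M'$ is a two-dimensional real vector space of Poisson bivector fields, or the zero space. Let $J'$ be a bihamiltonian structure on $M'$ of which $(M,J,\mathcal K)$ is a realization: $c_1,c_2$ are projectable via $p$ and their push-forwards $c_1',c_2'$ span $J'$. Let $R_0$ be the maximum of the ranks $\operatorname{rank}a(y)$ over all $a\in J'$ and $y\in M'$. Say that $J'$ is complete at $x'\in M'$ if every nonzero element of its complexification $\{a+ib : a,b\in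 J'\}$ has rank $R_0$ at $x'$, and assume that $J'$ is complete, i.e. complete at all points of some open dense set. Let $U'\subset M'$ be the largest open set on which $J'$ is complete at every point. Let $\mathcal L'$ be the bilagrangian foliation of $J'$ on $U'$, that is, the foliation whose equations are the local first integrals of $J'$, the sums of local Casimir functions of members $a\in J'$ of maximal rank, $\max_{y}\operatorname{rank}a(y)=R_0$; so $T_{x'}\mathcal L'$ is the common kernel of the differentials at $x'$ of all first integrals defined near $x'$. Let $\mathcal L=p^{-1}(\mathcal L')$ be the foliation of $p^{-1}(U')$ with tangent spaces $T_x\mathcal L=(dp_x)^{-1}(T_{p(x)}\mathcal L')$. Then the realization is minimal, that is, $\mathcal K$ is $CR$-isotropic: $$T_x^{1,0}\mathcal K\subset (T_x^{1,0}\mathcal K)^{\perp\omega(x)}\quad\text{for all }x\in M,$$ if and only if $\mathcal L$ is $CR$-lagrangian: $$(T_x^{1,0}\mathcal L)^{\perp\omega(x)}=T_x^{1,0}\mathcal L\quad\text{for all }x\in p^{-1}(U').$$ Here $\perp\omega(x)$ is the skew-orthogonal complement in $T^{1,0}_xM$ with respect to $\omega(x)$. -/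

import Mathlib

open scoped Manifold ContDiff

noncomputable section

namespace CRBihamiltonian

/-! ### Real bivector fields and bihamiltonian structures

Throughout, the tangent space of a manifold at a point is the model vector space, as in Mathlib's
`TangentSpace`: it is read in the preferred chart at that point. -/

section Bihamiltonian

variable {F : Type*} [NormedAddCommGroup F] [NormedSpace ℝ F]
  {N : Type*} [TopologicalSpace N] [ChartedSpace F N]

/-- A field of contravariant two-tensors on `N`: at each point a bilinear form on the cotangent
space. It is a bivector field if all these forms are alternating. -/
abbrev TensorField (F : Type*) [NormedAddCommGroup F] [NormedSpace ℝ F] (N : Type*) :=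
  N → LinearMap.BilinForm ℝ (Module.Dual ℝ F)

/-- The differential of a real function at a point, as a continuous linear map. -/
def differentialL (f : N → ℝ) (x : N) : F →L[ℝ] ℝ := mfderiv 𝓘(ℝ, F) 𝓘(ℝ, ℝ) f x

/-- The differential of a real function at a point. -/
def differential (f : N → ℝ) (x : N) : Module.Dual ℝ F :=
  (differentialL f x).toLinearMap

/-- The bracket `{f, g} = c(df, dg)`. -/
def bracket (c : TensorField F N) (f g : N → ℝ) (x : N) : ℝ :=
  c x (differential f x) (differential g x)

/-- `f` is a smooth function on `U`. -/
def SmoothOn (F : Type*) [NormedAddCommGroup F] [NormedSpace ℝ F]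
    {N : Type*} [TopologicalSpace N] [ChartedSpace F N] (f : N → ℝ) (U : Set N) : Prop :=
  ContMDiffOn 𝓘(ℝ, F) 𝓘(ℝ, ℝ) ∞ f U

/-- `c` is a smooth Poisson bivector field: it is alternating, the bracket of smooth functions
is smooth, and the bracket satisfies the Jacobi identity. -/
structure IsPoisson (c : TensorField F N) : Prop where
  alternating : ∀ x, (c x).IsAlt
  smooth : ∀ (U : Set N), IsOpen U → ∀ f g : N → ℝ, SmoothOn F f U → SmoothOn F g U →
    SmoothOn F (bracket c f g) U
  jacobi : ∀ (U : Set N), IsOpen U → ∀ f g h : N → ℝ,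
    SmoothOn F f U → SmoothOn F g U → SmoothOn F h U → ∀ x ∈ U,
      bracket c f (bracket c g h) x + bracket c g (bracket c h f) x
        + bracket c h (bracket c f g) x = 0

/-- A bihamiltonian structure on `N`: a two-dimensional real vector space of Poisson bivector
fields, or the zero space (the trivial bihamiltonian structure). -/
structure IsBihamiltonian (J : Submodule ℝ (TensorField F N)) : Prop where
  poisson : ∀ c ∈ J, IsPoisson c
  dim : Module.finrank ℝ J = 2 ∨ J = ⊥

/-- The rank of a bilinear form (of a bivector): the dimension of the image of
the map `V → V^*`, `v ↦ B(v, ·)`. -/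
def formRank {K V : Type*} [Field K] [AddCommGroup V] [Module K V]
    (B : LinearMap.BilinForm K V) : ℕ :=
  Module.finrank K (LinearMap.range B)

/-- The rank of a bivector field: the maximum of its ranks at the points of `N`. -/
def fieldRank (c : TensorField F N) : ℕ := ⨆ x : N, formRank (c x)

/-- The number `R₀`: the maximal rank of a member of `J`. -/
def maxRank (J : Submodule ℝ (TensorField F N)) : ℕ := ⨆ c : J, fieldRank (c : TensorField F N)

/-- The value at `x` of the complex bivector field `a + i b`, as a complex bilinear form on the
complexified cotangent space `ℂ ⊗ T^*_x N`. -/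
def complexValue (a b : TensorField F N) (x : N) :
    LinearMap.BilinForm ℂ (TensorProduct ℝ ℂ (Module.Dual ℝ F)) :=
  (a x).baseChange ℂ + Complex.I • (b x).baseChange ℂ

/-- `J` is complete at `x`: all nonzero members `a + i b` (`a, b ∈ J`) of the complexification
of `J` have rank `R₀` at `x`. -/
def CompleteAt (J : Submodule ℝ (TensorField F N)) (x : N) : Prop :=
  ∀ a ∈ J, ∀ b ∈ J, (a ≠ 0 ∨ b ≠ 0) → formRank (complexValue a b x) = maxRank J

/-- `J` is complete: it is complete at every point of some open dense set.
(The trivial structure is complete.) -/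
def IsCompleteBihamiltonian (J : Submodule ℝ (TensorField F N)) : Prop :=
  ∃ U : Set N, IsOpen U ∧ Dense U ∧ ∀ x ∈ U, CompleteAt J x

/-- The largest open set on which `J` is complete at each point; the bilagrangian foliation
of `J` lives there. -/
def completeLocus (J : Submodule ℝ (TensorField F N)) : Set N :=
  interior {x | CompleteAt J x}

/-- `f` is a Casimir function of `c` over `U`: it is smooth on `U` and `c(f) = c(df, ·)`
vanishes on `U`. -/
def IsCasimirOn (c : TensorField F N) (U : Set N) (f : N → ℝ) : Prop :=
  SmoothOn F f U ∧ ∀ x ∈ U, c x (differential f x) = 0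

/-- The first integrals of `J` over `U`: the sum over all `c ∈ J` of maximal rank `R₀` of the
spaces of Casimir functions of `c` over `U`. -/
def firstIntegrals (J : Submodule ℝ (TensorField F N)) (U : Set N) : Submodule ℝ (N → ℝ) :=
  Submodule.span ℝ {f | ∃ c ∈ J, fieldRank c = maxRank J ∧ IsCasimirOn c U f}

/-- The tangent space at `x` of the foliation defined by the local first integrals of `J`
(for `x` in the complete locus: the tangent space of the bilagrangian foliation of `J`), that is,
the common kernel of the differentials at `x` of all first integrals on neighbourhoods of `x`. -/
def bilagrangianTangent (J : Submodule ℝ (TensorField F N)) (x : N) : Submodule ℝ F where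
  carrier := {v | ∀ U : Set N, IsOpen U → x ∈ U → ∀ f ∈ firstIntegrals J U, differential f x v = 0}
  add_mem' := by
    intro v w hv hw U hU hx f hf
    rw [map_add, hv U hU hx f hf, hw U hU hx f hf, add_zero]
  zero_mem' := by
    intro U hU hx f hf
    exact map_zero _
  smul_mem' := by
    intro r v hv U hU hx f hf
    rw [map_smul, hv U hU hx f hf, smul_zero]

end Bihamiltonian

/-! ### Holomorphic symplectic manifolds -/

section Symplectic

variable {E : Type*} [NormedAddCommGroup E] [NormedSpace ℂ E]

/-- The complex bilinear form `(v, w) ↦ η(v, w)` of an alternating two-form. -/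
def toBilin (η : E [⋀^Fin 2]→L[ℂ] ℂ) : LinearMap.BilinForm ℂ E :=
  LinearMap.mk₂ ℂ (fun v w => η ![v, w])
    (fun v v' w => η.toMultilinearMap.cons_add _ _ _)
    (fun a v w => η.toMultilinearMap.cons_smul _ _ _)
    (fun v w w' => by
      have h (u : E) : Function.update ![v, w] 1 u = ![v, u] := by
        ext i; fin_cases i <;> rfl
      simpa only [h] using η.map_update_add ![v, w] 1 w w')
    (fun a v w => by
      have h (u : E) : Function.update ![v, w] 1 u = ![v, u] := by
        ext i; fin_cases i <;> rfl
      simpa only [h] using η.map_update_smul ![v, w] 1 a w)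

/-- The complex differential at `y` of the inverse of a chart. -/
def chartInverseDifferential {M : Type*} [TopologicalSpace M] [ChartedSpace E M]
    (e : OpenPartialHomeomorph M E) (y : E) : E →L[ℂ] E :=
  mfderiv 𝓘(ℂ, E) 𝓘(ℂ, E) e.symm y

/-- The expression of a two-form on `M` in the chart `e`: its pull-back by the inverse of `e`. -/
def formInChart {M : Type*} [TopologicalSpace M] [ChartedSpace E M]
    (η : M → E [⋀^Fin 2]→L[ℂ] ℂ) (e : OpenPartialHomeomorph M E) (y : E) : E [⋀^Fin 2]→L[ℂ] ℂ :=
  (η (e.symm y)).compContinuousLinearMap (chartInverseDifferential e y)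

/-- A holomorphic symplectic form on a complex manifold `M` modelled on `E`: a nondegenerate
`(2,0)`-form that is holomorphic and closed in the charts of `M`.

The holomorphic tangent space `T^{1,0}_x M` is identified with the real tangent space with its
complex structure (so with `E`) by `v ↦ (v - i 𝒥 v)/2`; a `(2,0)`-form is thereby a complex
bilinear alternating form on `E`, and equals the restriction of the form to real vectors. -/
structure HolomorphicSymplecticForm (E : Type*) [NormedAddCommGroup E] [NormedSpace ℂ E]
    (M : Type*) [TopologicalSpace M] [ChartedSpace E M] where
  toFun : M → E [⋀^Fin 2]→L[ℂ] ℂ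
  holomorphic : ∀ e ∈ atlas E M, DifferentiableOn ℂ (formInChart toFun e) e.target
  closed : ∀ e ∈ atlas E M, ∀ y ∈ e.target, extDeriv (formInChart toFun e) y = 0
  nondegenerate : ∀ x, (toBilin (toFun x)).Nondegenerate

/-- The `(1,0)`-part `v ↦ (α(v) - i α(i v))/2` of a real covector `α`, that is, the value of the
complex linear extension of `α` on the vector `(v - i 𝒥 v)/2` of type `(1,0)`. -/
def covectorOneZero (α : Module.Dual ℝ E) : Module.Dual ℂ E :=
  (1 / 2 : ℂ) • α.extendRCLikeₗ (𝕜 := ℂ)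

lemma covectorOneZero_add (α β : Module.Dual ℝ E) :
    covectorOneZero (α + β) = covectorOneZero α + covectorOneZero β := by
  simp [covectorOneZero]

lemma covectorOneZero_smul (r : ℝ) (α : Module.Dual ℝ E) :
    covectorOneZero (r • α) = (r : ℂ) • covectorOneZero α := by
  ext v
  simp [covectorOneZero, Module.Dual.extendRCLikeₗ_apply, Module.Dual.extendRCLike_apply]
  ring

variable [FiniteDimensional ℂ E] {M : Type*} [TopologicalSpace M] [ChartedSpace E M]

/-- For a complex covector `ξ` of type `(1,0)`, the vector `v` with `Ω(v, ·) = ξ`. -/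
def sharp (Ω : HolomorphicSymplecticForm E M) (x : M) : Module.Dual ℂ E ≃ₗ[ℂ] E :=
  ((toBilin (Ω.toFun x)).toDual (Ω.nondegenerate x)).symm

/-- The value on real covectors of the holomorphic bivector field `c = Ω⁻¹`: the form `Ω`
transported to covectors by the isomorphism of the tangent and cotangent spaces given by `Ω`. -/
def inverseBivector (Ω : HolomorphicSymplecticForm E M) (x : M) (α β : Module.Dual ℝ E) : ℂ :=
  toBilin (Ω.toFun x) (sharp Ω x (covectorOneZero α)) (sharp Ω x (covectorOneZero β))

lemma inverseBivector_smul_left (Ω : HolomorphicSymplecticForm E M) (x : M) (r : ℝ)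
    (α β : Module.Dual ℝ E) :
    inverseBivector Ω x (r • α) β = (r : ℂ) * inverseBivector Ω x α β := by
  unfold inverseBivector
  rw [covectorOneZero_smul, LinearEquiv.map_smul, LinearMap.map_smul, LinearMap.smul_apply,
    smul_eq_mul]

lemma inverseBivector_smul_right (Ω : HolomorphicSymplecticForm E M) (x : M) (r : ℝ)
    (α β : Module.Dual ℝ E) :
    inverseBivector Ω x α (r • β) = (r : ℂ) * inverseBivector Ω x α β := by
  unfold inverseBivector
  rw [covectorOneZero_smul, LinearEquiv.map_smul, LinearMap.map_smul, smul_eq_mul]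

/-- The real bivector field `Re c`, where `c = Ω⁻¹`. -/
def reBivector (Ω : HolomorphicSymplecticForm E M) : TensorField E M := fun x =>
  LinearMap.mk₂ ℝ (fun α β => (inverseBivector Ω x α β).re)
    (by intro α α' β; simp [inverseBivector, covectorOneZero_add])
    (by intro r α β; simp [inverseBivector_smul_left])
    (by intro α β β'; simp [inverseBivector, covectorOneZero_add])
    (by intro r α β; simp [inverseBivector_smul_right])

/-- The real bivector field `Im c`, where `c = Ω⁻¹`. -/
def imBivector (Ω : HolomorphicSymplecticForm E M) : TensorField E M := fun x =>
  LinearMap.mk₂ ℝ (fun α β => (inverseBivector Ω x α β).im)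
    (by intro α α' β; simp [inverseBivector, covectorOneZero_add])
    (by intro r α β; simp [inverseBivector_smul_left])
    (by intro α β β'; simp [inverseBivector, covectorOneZero_add])
    (by intro r α β; simp [inverseBivector_smul_right])

end Symplectic

/-! ### Foliations and CR-geometry -/

section CR

variable {E : Type*} [NormedAddCommGroup E] [NormedSpace ℂ E]

/-- Multiplication by `i` on the tangent spaces of a complex manifold. -/
def complexStructure (E : Type*) [NormedAddCommGroup E] [NormedSpace ℂ E] : E →ₗ[ℝ] E :=
  (Complex.I • (LinearMap.id : E →ₗ[ℂ] E)).restrictScalars ℝ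

/-- For a real subspace `D` of a complex vector space, the complex subspace `D ∩ i D`. For
`D = T_x L` this is `T^{CR}_x L`, identified with `T^{1,0}_x L` by `v ↦ (v - i 𝒥 v)/2`. -/
def crSubspace (D : Submodule ℝ E) : Submodule ℂ E where
  carrier := {v | v ∈ D ∧ v ∈ D.map (complexStructure E)}
  add_mem' := fun hv hw => ⟨D.add_mem hv.1 hw.1, Submodule.add_mem _ hv.2 hw.2⟩
  zero_mem' := ⟨D.zero_mem, Submodule.zero_mem _⟩
  smul_mem' := by
    rintro a v ⟨h1, w, hw, rfl⟩
    have hI : Complex.I • complexStructure E w = -w := by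
      simp [complexStructure, smul_smul]
    have ha : a • complexStructure E w = a.re • complexStructure E w - a.im • w := by
      conv_lhs => rw [← Complex.re_add_im a]
      rw [add_smul, mul_smul, hI, smul_neg, Complex.coe_smul, Complex.coe_smul, sub_eq_add_neg]
    have hb : a • complexStructure E w = complexStructure E (a.re • w +
        a.im • complexStructure E w) := by
      rw [ha, map_add, map_smul, map_smul]
      have : complexStructure E (complexStructure E w) = -w := hI
      rw [this, smul_neg, sub_eq_add_neg]
    refine ⟨?_, ?_⟩
    · rw [ha]
      exact D.sub_mem (D.smul_mem _ h1) (D.smul_mem _ hw)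
    · rw [hb]
      exact Submodule.mem_map_of_mem (D.add_mem (D.smul_mem _ hw) (D.smul_mem _ h1))

variable {M : Type*} [TopologicalSpace M] [ChartedSpace E M]

/-- The foliation of an open set `U` with tangent spaces `D x` is `CR`-isotropic:
`T^{1,0}` is contained in its skew-orthogonal complement with respect to `Ω`. -/
def IsCRIsotropicOn (Ω : HolomorphicSymplecticForm E M) (U : Set M) (D : M → Submodule ℝ E) :
    Prop :=
  ∀ x ∈ U, crSubspace (D x) ≤ (toBilin (Ω.toFun x)).orthogonal (crSubspace (D x))

/-- The foliation of an open set `U` with tangent spaces `D x` is `CR`-lagrangian: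
`T^{1,0}` is equal to its skew-orthogonal complement with respect to `Ω`.
(In particular the dimension of `T^{1,0}` is half of that of `M`, hence constant.) -/
def IsCRLagrangianOn (Ω : HolomorphicSymplecticForm E M) (U : Set M) (D : M → Submodule ℝ E) :
    Prop :=
  ∀ x ∈ U, (toBilin (Ω.toFun x)).orthogonal (crSubspace (D x)) = crSubspace (D x)

variable {E' : Type*} [NormedAddCommGroup E'] [NormedSpace ℝ E']
  {M' : Type*} [TopologicalSpace M'] [ChartedSpace E' M']

/-- The real differential of a map from a complex manifold to a real manifold, as a continuous
linear map. -/
def realDifferentialL (E E' : Type*) [NormedAddCommGroup E] [NormedSpace ℂ E]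
    [NormedAddCommGroup E'] [NormedSpace ℝ E']
    {M : Type*} [TopologicalSpace M] [ChartedSpace E M]
    {M' : Type*} [TopologicalSpace M'] [ChartedSpace E' M'] (p : M → M') (x : M) : E →L[ℝ] E' :=
  mfderiv 𝓘(ℝ, E) 𝓘(ℝ, E') p x

/-- The real differential of a map from a complex manifold to a real manifold. -/
def realDifferential (E E' : Type*) [NormedAddCommGroup E] [NormedSpace ℂ E]
    [NormedAddCommGroup E'] [NormedSpace ℝ E']
    {M : Type*} [TopologicalSpace M] [ChartedSpace E M]
    {M' : Type*} [TopologicalSpace M'] [ChartedSpace E' M'] (p : M → M') (x : M) : E →ₗ[ℝ] E' :=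
  (realDifferentialL E E' p x).toLinearMap

/-- `p : M → M'` is a smooth surjective submersion with connected fibres
(`IsConnected` includes non-emptiness). -/
structure IsFibration (E E' : Type*) [NormedAddCommGroup E] [NormedSpace ℂ E]
    [NormedAddCommGroup E'] [NormedSpace ℝ E']
    {M : Type*} [TopologicalSpace M] [ChartedSpace E M]
    {M' : Type*} [TopologicalSpace M'] [ChartedSpace E' M'] (p : M → M') : Prop where
  smooth : ContMDiff 𝓘(ℝ, E) 𝓘(ℝ, E') ∞ p
  submersion : ∀ x, Function.Surjective (realDifferential E E' p x)
  connected : ∀ x' : M', IsConnected (p ⁻¹' {x'})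

/-- The tangent spaces of the foliation `𝒦` of `M` by the fibres of `p`. -/
def fibreTangent (E E' : Type*) [NormedAddCommGroup E] [NormedSpace ℂ E]
    [NormedAddCommGroup E'] [NormedSpace ℝ E']
    {M : Type*} [TopologicalSpace M] [ChartedSpace E M]
    {M' : Type*} [TopologicalSpace M'] [ChartedSpace E' M'] (p : M → M') (x : M) :
    Submodule ℝ E :=
  LinearMap.ker (realDifferential E E' p x)

/-- The foliation `𝒦` by the fibres of `p` is a generic `CR`-foliation: along each fibre
the dimension of `T^{1,0}𝒦` is constant, and `T𝒦 + 𝒥 T𝒦 = TM`. -/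
structure IsGenericCRFibration (E E' : Type*) [NormedAddCommGroup E] [NormedSpace ℂ E]
    [NormedAddCommGroup E'] [NormedSpace ℝ E']
    {M : Type*} [TopologicalSpace M] [ChartedSpace E M]
    {M' : Type*} [TopologicalSpace M'] [ChartedSpace E' M'] (p : M → M') : Prop where
  constant_dim : ∀ x' : M', ∃ d : ℕ, ∀ x ∈ p ⁻¹' {x'},
    Module.finrank ℂ (crSubspace (fibreTangent E E' p x)) = d
  generic : ∀ x, fibreTangent E E' p x ⊔ (fibreTangent E E' p x).map (complexStructure E) = ⊤

/-- The tangent spaces of the pull-back `p⁻¹(𝓛')` of the foliation `𝓛'` of (an open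
subset of) `M'` with tangent spaces `D'`. -/
def pullbackTangent (p : M → M') (D' : M' → Submodule ℝ E') (x : M) : Submodule ℝ E :=
  (D' (p x)).comap (realDifferential E E' p x)

/-- `c` is projectable via `p` with push-forward `c'`: the image of `c` at `x` under the
differential of `p` is `c'` at `p x`, for all `x`. -/
def IsPushforward (p : M → M') (c : TensorField E M) (c' : TensorField E' M') : Prop :=
  ∀ (x : M) (α β : Module.Dual ℝ E'),
    c' (p x) α β = c x (α ∘ₗ realDifferential E E' p x) (β ∘ₗ realDifferential E E' p x)

variable [FiniteDimensional ℂ E]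

/-- The holomorphic symplectic bihamiltonian structure `J`, spanned by `Re c` and `Im c`
with `c = Ω⁻¹`, is, together with the foliation by the fibres of `p`, a realization
of `J'`: `p` is a surjective submersion with connected fibres, `Re c` and `Im c` are
projectable, and `J'` is spanned by their push-forwards. -/
structure IsRealization (Ω : HolomorphicSymplecticForm E M) (p : M → M')
    (J' : Submodule ℝ (TensorField E' M')) : Prop where
  fibration : IsFibration E E' p
  pushforward : ∃ c₁' c₂' : TensorField E' M',
    IsPushforward p (reBivector Ω) c₁' ∧ IsPushforward p (imBivector Ω) c₂' ∧
      J' = Submodule.span ℝ {c₁', c₂'}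

/-- The realization is minimal: the foliation `𝒦` by the fibres of `p` is `CR`-isotropic. -/
def IsMinimal (E' : Type*) [NormedAddCommGroup E'] [NormedSpace ℝ E']
    {M' : Type*} [TopologicalSpace M'] [ChartedSpace E' M']
    (Ω : HolomorphicSymplecticForm E M) (p : M → M') : Prop :=
  IsCRIsotropicOn Ω Set.univ (fibreTangent E E' p)

end CR

end CRBihamiltonian

end

open CRBihamiltonian

/-! Let f be the complex linear map `complexLift` from T*M'⊗ℂ to T_xM taking a covector of M' to the
Hamiltonian vector of the (1,0)-part of its pull-back. Two facts turn the CR-conditions into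
symplectic linear algebra. The form induced by ω through f is the projected bivector c' = c₁' + i
c₂' (`toBilin_complexLift_eq_complexValue`). For a subspace D' of a tangent space of M', the
CR-space of its preimage is the skew-orthogonal complement of f(Ann D' ⊗ ℂ) (`crSubspace_comap`).
With D' = 0 this gives T^{1,0}𝒦 = (im f)^⊥, so minimality says that im f is coisotropic. With D' =
Tℒ' it gives T^{1,0}ℒ = f(Φ)^⊥, where Φ = Ann(Tℒ') ⊗ ℂ.

The key point is that over U' the space Φ is its own complement for c'
(`mem_baseChange_dualAnnihilator_bilagrangianTangent_iff`). The algebraic half is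
`HasConstantRank.mem_pencilCore_iff`: in a complex pencil of alternating forms of constant rank, the
span of the kernels is its own complement for every nonzero member, since anything larger would
produce an eigenvalue and with it a degenerate member. The analytic half identifies Φ with that
span: a covector in the kernel of a Poisson bivector of locally constant rank is the differential of
a Casimir function (`exists_casimir`). This is the Frobenius theorem for the image distribution,
involutive by the Jacobi identity. First integrals are found by sliding points along rays inside the
leaves, and the inverse function theorem in a space of paths provides both the rays and their smooth
dependence on the starting point.

If im f is coisotropic, f carries Φ to a lagrangian subspace (`orthogonal_map_eq`), so ℒ is
CR-lagrangian. Conversely, over U' the space T^{1,0}𝒦 lies in the lagrangian T^{1,0}ℒ and is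
therefore isotropic. To leave U', genericity makes f injective, and isotropy at x becomes the bound
rank c'(p(x)) + dim_ℂ M ≤ 2 dim M'. Rank is lower semicontinuous, so the bound extends from the
dense set U' to M'. -/

noncomputable section

namespace CRBihamiltonian

/-! ### Calculus in spaces of continuous maps -/

section PathCalculus

universe u

variable {K : Type*} [TopologicalSpace K] [CompactSpace K]

/-- A continuous bilinear map, applied pointwise to continuous maps. -/
def pointwiseBilin (K : Type*) [TopologicalSpace K] [CompactSpace K] {E F G : Type*}
    [NormedAddCommGroup E] [NormedSpace ℝ E] [NormedAddCommGroup F] [NormedSpace ℝ F]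
    [NormedAddCommGroup G] [NormedSpace ℝ G] (B : E →L[ℝ] F →L[ℝ] G) :
    C(K, E) →L[ℝ] C(K, F) →L[ℝ] C(K, G) :=
  LinearMap.mkContinuous₂
    (LinearMap.mk₂ ℝ (fun a b => ⟨fun t => B (a t) (b t), by fun_prop⟩)
      (by intro a a' b; ext t; simp) (by intro r a b; ext t; simp)
      (by intro a b b'; ext t; simp) (by intro r a b; ext t; simp)) ‖B‖ (by
      intro a b
      refine (ContinuousMap.norm_le _ (by positivity)).2 fun t => ?_
      refine (B.le_opNorm₂ (a t) (b t)).trans ?_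
      gcongr
      · exact a.norm_coe_le_norm t
      · exact b.norm_coe_le_norm t)

@[simp]
lemma pointwiseBilin_apply {E F G : Type*}
    [NormedAddCommGroup E] [NormedSpace ℝ E] [NormedAddCommGroup F] [NormedSpace ℝ F]
    [NormedAddCommGroup G] [NormedSpace ℝ G] (B : E →L[ℝ] F →L[ℝ] G) (a : C(K, E)) (b : C(K, F))
    (t : K) : pointwiseBilin K B a b t = B (a t) (b t) := rfl

/-- Composition with a map is differentiable on continuous maps, with the derivative applied
pointwise. -/
lemma hasFDerivAt_comp_continuousMap {E F : Type*}
    [NormedAddCommGroup E] [NormedSpace ℝ E] [NormedAddCommGroup F] [NormedSpace ℝ F]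
    (f : C(E, F)) (f' : C(E, E →L[ℝ] F)) (hf : ∀ x, HasFDerivAt f (f' x) x) (γ : C(K, E)) :
    HasFDerivAt (fun γ : C(K, E) => f.comp γ)
      (pointwiseBilin K (ContinuousLinearMap.id ℝ (E →L[ℝ] F)) (f'.comp γ)) γ := by
  rw [hasFDerivAt_iff_isLittleO_nhds_zero, Asymptotics.isLittleO_iff]
  intro ε hε
  -- Continuity of this map into the sup-norm space gives a single δ for all points of `K`: the
  -- derivative varies by less than ε on the δ-ball around every `γ t`.
  have hc : Continuous fun e : E => f'.comp (γ + ContinuousMap.const K e) :=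
    f'.continuous_postcomp.comp (continuous_const.add ContinuousMap.continuous_const')
  obtain ⟨δ, hδ, h⟩ := Metric.mem_nhds_iff.1 (hc.continuousAt.preimage_mem_nhds (x := 0)
    (Metric.ball_mem_nhds (f'.comp (γ + ContinuousMap.const K (0 : E))) hε))
  filter_upwards [Metric.ball_mem_nhds (0 : C(K, E)) hδ] with g hg
  refine (ContinuousMap.norm_le _ (by positivity)).2 fun t => ?_
  have key : ∀ y ∈ Metric.ball (γ t) δ, ‖f' y - f' (γ t)‖ ≤ ε := by
    intro y hy
    have h1 : dist (f'.comp (γ + ContinuousMap.const K (y - γ t)))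
        (f'.comp (γ + ContinuousMap.const K 0)) < ε :=
      h (by simpa [dist_eq_norm] using hy : y - γ t ∈ Metric.ball 0 δ)
    have h2 := (ContinuousMap.dist_apply_le_dist (f := f'.comp (γ + ContinuousMap.const K (y - γ t)))
      (g := f'.comp (γ + ContinuousMap.const K 0)) t).trans h1.le
    simpa [dist_eq_norm] using h2
  have hgt : ‖g t‖ < δ := (g.norm_coe_le_norm t).trans_lt (by simpa using hg)
  have := (convex_ball (γ t) δ).norm_image_sub_le_of_norm_hasFDerivWithin_le' (f := f) (f' := f')
    (φ := f' (γ t)) (C := ε) (x := γ t) (y := γ t + g t)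
    (fun x _ => (hf x).hasFDerivWithinAt) key (Metric.mem_ball_self hδ) (by simpa using hgt)
  simp only [add_sub_cancel_left] at this
  exact this.trans (mul_le_mul_of_nonneg_left (g.norm_coe_le_norm t) hε.le)

/-- The derivative is again a postcomposition, by f', followed by a fixed continuous linear map, so
induction applies. The target `F` varies in the induction, because f' takes values in `E →L[ℝ] F`;
both spaces share a universe to keep this target admissible. -/
lemma contDiff_nat_comp_continuousMap {E : Type u} [NormedAddCommGroup E] [NormedSpace ℝ E] (n : ℕ) :
    ∀ {F : Type u} [NormedAddCommGroup F] [NormedSpace ℝ F] (f : C(E, F)), ContDiff ℝ n f →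
      ContDiff ℝ n (fun γ : C(K, E) => f.comp γ) := by
  induction n with
  | zero =>
    intro F _ _ f _
    have h : Continuous fun γ : C(K, E) => f.comp γ := f.continuous_postcomp
    exact_mod_cast contDiff_zero.2 h
  | succ n ih =>
    intro F _ _ f hf
    obtain ⟨f', hf', h⟩ := contDiff_succ_iff_hasFDerivAt.1 hf
    refine contDiff_succ_iff_hasFDerivAt.2 ⟨_, ?_, fun γ =>
      hasFDerivAt_comp_continuousMap f ⟨f', hf'.continuous⟩ h γ⟩
    exact (ContinuousLinearMap.contDiff _).comp (ih ⟨f', hf'.continuous⟩ hf')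

/-- Composition with a smooth map is smooth on continuous maps. -/
lemma contDiff_comp_continuousMap {E F : Type u} [NormedAddCommGroup E] [NormedSpace ℝ E]
    [NormedAddCommGroup F] [NormedSpace ℝ F] (f : C(E, F)) (hf : ContDiff ℝ ∞ f) :
    ContDiff ℝ ∞ (fun γ : C(K, E) => f.comp γ) :=
  contDiff_infty.2 fun n => contDiff_nat_comp_continuousMap n f (contDiff_infty.1 hf n)

/-- The primitive vanishing at `0`, as an operator on continuous maps on `[0, 1]`. -/
def primitive (F : Type*) [NormedAddCommGroup F] [NormedSpace ℝ F] :
    C(unitInterval, F) →L[ℝ] C(unitInterval, F) :=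
  LinearMap.mkContinuous
    { toFun := fun g => ⟨fun s => ∫ t in (0 : ℝ)..s, g (Set.projIcc 0 1 zero_le_one t),
        (intervalIntegral.continuous_primitive (fun a b => Continuous.intervalIntegrable
          (g.continuous.comp continuous_projIcc) a b) 0).comp continuous_subtype_val⟩
      map_add' := by
        intro g h
        ext s
        exact intervalIntegral.integral_add
          ((g.continuous.comp continuous_projIcc).intervalIntegrable _ _)
          ((h.continuous.comp continuous_projIcc).intervalIntegrable _ _)
      map_smul' := by
        intro r g
        ext s
        exact intervalIntegral.integral_smul r _ } 1 (by
    intro g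
    refine (ContinuousMap.norm_le _ (by positivity)).2 fun s => ?_
    refine (intervalIntegral.norm_integral_le_of_norm_le_const (C := ‖g‖)
      fun t _ => g.norm_coe_le_norm _).trans ?_
    have h0 := s.2.1
    have h1 := s.2.2
    rw [sub_zero, abs_of_nonneg h0, one_mul]
    exact mul_le_of_le_one_right (norm_nonneg _) h1)

lemma primitive_apply {F : Type*} [NormedAddCommGroup F] [NormedSpace ℝ F]
    (g : C(unitInterval, F)) (s : unitInterval) :
    primitive F g s = ∫ t in (0 : ℝ)..s, g (Set.projIcc 0 1 zero_le_one t) := rfl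

end PathCalculus

/-! ### First integrals of involutive graph distributions -/

section Frobenius

open Filter Topology

universe u

variable {X Y : Type u} [NormedAddCommGroup X] [NormedSpace ℝ X]
  [NormedAddCommGroup Y] [NormedSpace ℝ Y]

/-- The constant path, as a continuous linear map. -/
def constPath (F : Type*) [NormedAddCommGroup F] [NormedSpace ℝ F] :
    F →L[ℝ] C(unitInterval, F) :=
  LinearMap.mkContinuous
    { toFun := fun y => ContinuousMap.const _ y
      map_add' := fun _ _ => rfl
      map_smul' := fun _ _ => rfl } 1 (by
    intro y
    rw [one_mul]
    exact (ContinuousMap.norm_le _ (norm_nonneg y)).2 fun s => le_rfl)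

@[simp]
lemma constPath_apply {F : Type*} [NormedAddCommGroup F] [NormedSpace ℝ F] (y : F)
    (s : unitInterval) : constPath F y s = y := rfl

/-- The path `s ↦ ((1 - s) x, γ s)` associated with `((x, y), γ)`. -/
def rayPath (X Y : Type*) [NormedAddCommGroup X] [NormedSpace ℝ X]
    [NormedAddCommGroup Y] [NormedSpace ℝ Y] :
    (X × Y) × C(unitInterval, Y) →L[ℝ] C(unitInterval, X × Y) :=
  (((ContinuousLinearMap.inl ℝ X Y).compLeftContinuous ℝ unitInterval).comp
    (pointwiseBilin unitInterval (ContinuousLinearMap.lsmul ℝ ℝ)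
      (⟨fun s => 1 - (s : ℝ), by fun_prop⟩ : C(unitInterval, ℝ)))).comp
    ((constPath X).comp ((ContinuousLinearMap.fst ℝ X Y).comp (ContinuousLinearMap.fst ℝ _ _)))
  + ((ContinuousLinearMap.inr ℝ X Y).compLeftContinuous ℝ unitInterval).comp
    (ContinuousLinearMap.snd ℝ _ _)

@[simp]
lemma rayPath_apply (q : (X × Y) × C(unitInterval, Y)) (s : unitInterval) :
    rayPath X Y q s = ((1 - (s : ℝ)) • q.1.1, q.2 s) := by
  simp [rayPath, sub_smul]

/-- The equation `γ' = - A((1 - s) x, γ) x`, `γ 0 = y`, in integral form. -/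
def rayMap (A : C(X × Y, X →L[ℝ] Y)) (q : (X × Y) × C(unitInterval, Y)) :
    (X × Y) × C(unitInterval, Y) :=
  (q.1, q.2 - constPath Y q.1.2 + primitive Y (pointwiseBilin unitInterval
    (ContinuousLinearMap.id ℝ (X →L[ℝ] Y)) (A.comp (rayPath X Y q)) (constPath X q.1.1)))

lemma contDiff_rayMap (A : C(X × Y, X →L[ℝ] Y)) (hA : ContDiff ℝ ∞ A) :
    ContDiff ℝ ∞ (rayMap A) := by
  have h1 : ContDiff ℝ ∞ fun q : (X × Y) × C(unitInterval, Y) => A.comp (rayPath X Y q) :=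
    (contDiff_comp_continuousMap A hA).comp (rayPath X Y).contDiff
  have h2 : ContDiff ℝ ∞ fun q : (X × Y) × C(unitInterval, Y) => constPath X q.1.1 :=
    (constPath X).contDiff.comp (contDiff_fst.comp contDiff_fst)
  have h3 : ContDiff ℝ ∞ fun q : (X × Y) × C(unitInterval, Y) => constPath Y q.1.2 :=
    (constPath Y).contDiff.comp (contDiff_snd.comp contDiff_fst)
  refine contDiff_fst.prodMk ((contDiff_snd.sub h3).add ((primitive Y).contDiff.comp ?_))
  exact ((ContinuousLinearMap.contDiff (pointwiseBilin unitInterval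
    (ContinuousLinearMap.id ℝ (X →L[ℝ] Y)))).comp h1).clm_apply h2

lemma fderiv_rayMap (A : C(X × Y, X →L[ℝ] Y))
    (A' : C(X × Y, X × Y →L[ℝ] X →L[ℝ] Y)) (hA' : ∀ q, HasFDerivAt A (A' q) q)
    (q v : (X × Y) × C(unitInterval, Y)) :
    fderiv ℝ (rayMap A) q v = (v.1, v.2 - constPath Y v.1.2 + primitive Y
      (pointwiseBilin unitInterval (ContinuousLinearMap.id ℝ (X →L[ℝ] Y))
        (A.comp (rayPath X Y q)) (constPath X v.1.1)
      + pointwiseBilin unitInterval (ContinuousLinearMap.id ℝ (X →L[ℝ] Y))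
        (pointwiseBilin unitInterval (E := X × Y →L[ℝ] X →L[ℝ] Y) (F := X × Y)
          (ContinuousLinearMap.id ℝ (X × Y →L[ℝ] X →L[ℝ] Y))
        (A'.comp (rayPath X Y q)) (rayPath X Y v)) (constPath X q.1.1))) := by
  have h1 := (hasFDerivAt_comp_continuousMap A A' hA' (rayPath X Y q)).comp q
    (rayPath X Y).hasFDerivAt
  have h2 := ((constPath X).comp ((ContinuousLinearMap.fst ℝ X Y).comp
    (ContinuousLinearMap.fst ℝ (X × Y) C(unitInterval, Y)))).hasFDerivAt (x := q)
  have h3 := ((constPath Y).comp ((ContinuousLinearMap.snd ℝ X Y).comp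
    (ContinuousLinearMap.fst ℝ (X × Y) C(unitInterval, Y)))).hasFDerivAt (x := q)
  have h4 := (pointwiseBilin unitInterval
    (ContinuousLinearMap.id ℝ (X →L[ℝ] Y))).hasFDerivAt_of_bilinear h1 h2
  have h5 := (hasFDerivAt_fst (𝕜 := ℝ) (p := q)).prodMk
    (((hasFDerivAt_snd (𝕜 := ℝ) (p := q)).sub h3).add ((primitive Y).hasFDerivAt.comp q h4))
  have h6 : HasFDerivAt (rayMap A) _ q := h5
  rw [h6.fderiv]
  rfl

end Frobenius

/-! ### Solving the ray equation by the inverse function theorem -/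

section Frobenius

open Filter Topology

universe u

variable {X Y : Type u} [NormedAddCommGroup X] [NormedSpace ℝ X]
  [NormedAddCommGroup Y] [NormedSpace ℝ Y]

/-- The shear `(v, w) ↦ (v, w + l v)`. -/
def shear {V W : Type*} [NormedAddCommGroup V] [NormedSpace ℝ V] [NormedAddCommGroup W]
    [NormedSpace ℝ W] (l : V →L[ℝ] W) : (V × W) ≃L[ℝ] (V × W) :=
  ContinuousLinearEquiv.equivOfInverse
    ((ContinuousLinearMap.fst ℝ V W).prod
      (ContinuousLinearMap.snd ℝ V W + l.comp (ContinuousLinearMap.fst ℝ V W)))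
    ((ContinuousLinearMap.fst ℝ V W).prod
      (ContinuousLinearMap.snd ℝ V W - l.comp (ContinuousLinearMap.fst ℝ V W)))
    (fun q => by simp) (fun q => by simp)

/-- At x = 0 the integrand A(·)x is linear in x, so varying the path contributes nothing to its
derivative. The derivative of `rayMap` is therefore the identity on paths plus a term depending only
on the variation of (x, y): a shear, which is invertible without any smallness condition. -/
lemma exists_equiv_fderiv_rayMap (A : C(X × Y, X →L[ℝ] Y)) (hA : ContDiff ℝ ∞ A) (y : Y) :
    ∃ e : ((X × Y) × C(unitInterval, Y)) ≃L[ℝ] ((X × Y) × C(unitInterval, Y)),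
      HasFDerivAt (rayMap A) (e : _ →L[ℝ] _) ((0, y), constPath Y y) := by
  have hd := (contDiff_rayMap A hA).differentiable (by simp) ((0, y), constPath Y y)
  refine ⟨shear ((ContinuousLinearMap.snd ℝ _ _).comp ((fderiv ℝ (rayMap A)
    ((0, y), constPath Y y)).comp (ContinuousLinearMap.inl ℝ _ _))), ?_⟩
  convert! hd.hasFDerivAt using 1
  refine ContinuousLinearMap.ext fun v => ?_
  have hA' (q) : HasFDerivAt A ((⟨fderiv ℝ A, hA.continuous_fderiv (by simp)⟩ :
      C(X × Y, X × Y →L[ℝ] X →L[ℝ] Y)) q) q :=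
    (hA.differentiable (by simp) q).hasFDerivAt
  have h0 (B : C(unitInterval, X →L[ℝ] Y)) : pointwiseBilin unitInterval
      (ContinuousLinearMap.id ℝ (X →L[ℝ] Y)) B (constPath X 0) = 0 := by
    ext s; simp
  refine Prod.ext ?_ ?_
  · rw [fderiv_rayMap A _ hA']
    rfl
  · change v.2 + (fderiv ℝ (rayMap A) ((0, y), constPath Y y) (v.1, 0)).2 = _
    rw [fderiv_rayMap A _ hA', fderiv_rayMap A _ hA']
    simp only [h0, add_zero]
    abel

/-- The field `(1 - s) A ξ` along a ray solves the variational equation, by involutivity. -/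
lemma fderiv_rayMap_eq (A : C(X × Y, X →L[ℝ] Y)) [CompleteSpace Y]
    (A' : C(X × Y, X × Y →L[ℝ] X →L[ℝ] Y)) (hA' : ∀ q, HasFDerivAt A (A' q) q)
    (q : (X × Y) × C(unitInterval, Y)) (hq : (rayMap A q).2 = 0)
    (hflat : ∀ s, ∀ ξ ζ, A' (rayPath X Y q s) (ξ, A (rayPath X Y q s) ξ) ζ =
      A' (rayPath X Y q s) (ζ, A (rayPath X Y q s) ζ) ξ) (ξ : X) :
    ∃ w : C(unitInterval, Y), w 1 = 0 ∧
      fderiv ℝ (rayMap A) q ((ξ, A q.1 ξ), w) = ((ξ, A q.1 ξ), 0) := by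
  set c := rayPath X Y q with hc
  set x := q.1.1 with hx
  set h : ℝ → Y := fun t => A (c (Set.projIcc 0 1 zero_le_one t)) x with hh
  have hcont : Continuous h := by
    have : Continuous fun t : ℝ => A (c (Set.projIcc 0 1 zero_le_one t)) :=
      A.continuous.comp (c.continuous.comp continuous_projIcc)
    fun_prop
  -- The path is extended to all real times by its own integral equation, with integrand frozen
  -- outside [0, 1]; two-sided derivatives then exist at the endpoints too.
  set g : ℝ → Y := fun t => q.1.2 - ∫ τ in (0 : ℝ)..t, h τ with hg
  have hgd (t : ℝ) : HasDerivAt g (-h t) t := by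
    have := (intervalIntegral.integral_hasDerivAt_right (hcont.intervalIntegrable 0 t)
      (hcont.stronglyMeasurableAtFilter _ _) hcont.continuousAt)
    simpa using! this.const_sub q.1.2
  have hgq (s : unitInterval) : g s = q.2 s := by
    have := congrArg (fun γ : C(unitInterval, Y) => γ s) hq
    have h2 : q.2 s - q.1.2 + ∫ τ in (0 : ℝ)..s, h τ = 0 := this
    rw [hg]
    simp only
    rw [← sub_eq_zero, ← neg_eq_zero, ← h2]
    abel
  set ce : ℝ → X × Y := fun t => ((1 - t) • x, g t) with hce
  have hcec (s : unitInterval) : ce s = c s := by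
    simp [hce, hc, hgq, hx]
  have hced (t : ℝ) : HasDerivAt ce (-x, -h t) t := by
    have h1 : HasDerivAt (fun t : ℝ => (1 - t) • x) (-x) t := by
      simpa using ((hasDerivAt_id t).const_sub 1).smul_const x
    exact h1.prodMk (hgd t)
  -- When x moves in direction ξ, the point (1 - t)x moves by (1 - t)ξ; `W` is the vertical
  -- component that keeps this variation tangent to the distribution. It vanishes at t = 1.
  set W : ℝ → Y := fun t => (1 - t) • A (ce t) ξ with hW
  have hWd (t : ℝ) : HasDerivAt W ((1 - t) • A' (ce t) (-x, -h t) ξ + (-1 : ℝ) • A (ce t) ξ) t := by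
    have h1 := (hA' (ce t)).comp_hasDerivAt t (hced t)
    have h2 := h1.clm_apply (hasDerivAt_const t ξ)
    have h3 := ((hasDerivAt_id t).const_sub 1).smul h2
    simpa using! h3
  let w : C(unitInterval, Y) := ⟨fun s => W s,
    (continuous_iff_continuousAt.2 fun t => (hWd t).continuousAt).comp continuous_subtype_val⟩
  refine ⟨w, by simp [w, hW], ?_⟩
  rw [fderiv_rayMap A A' hA']
  refine Prod.ext rfl ?_
  ext s
  simp only [ContinuousMap.add_apply, ContinuousMap.sub_apply, constPath_apply,
    primitive_apply, pointwiseBilin_apply, ContinuousMap.zero_apply]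
  have hint : ∀ t ∈ Set.uIcc (0 : ℝ) s, HasDerivAt W
      (-(A (c (Set.projIcc 0 1 zero_le_one t)) ξ +
        A' (c (Set.projIcc 0 1 zero_le_one t))
          (rayPath X Y ((ξ, A q.1 ξ), w) (Set.projIcc 0 1 zero_le_one t)) x)) t := by
    intro t ht
    rw [Set.uIcc_of_le s.2.1] at ht
    have ht' : t ∈ Set.Icc (0 : ℝ) 1 := ⟨ht.1, ht.2.trans s.2.2⟩
    convert! hWd t using 1
    rw [Set.projIcc_of_mem zero_le_one ht']
    have e1 : ce t = c ⟨t, ht'⟩ := hcec ⟨t, ht'⟩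
    have e2 : h t = A (c ⟨t, ht'⟩) x := by rw [hh]; simp only [Set.projIcc_of_mem zero_le_one ht']
    have e3 : rayPath X Y ((ξ, A q.1 ξ), w) ⟨t, ht'⟩ = (1 - t) • (ξ, A (c ⟨t, ht'⟩) ξ) := by
      rw [rayPath_apply]
      simp [w, hW, e1]
    -- Flatness exchanges ξ and x in the derivative of `A`, which turns the derivative of `W` along
    -- the ray into the right-hand side of the linearised ray equation.
    rw [e1, e2, e3, map_smul, smul_apply, hflat,
      show (-x, -A (c ⟨t, ht'⟩) x) = -(x, A (c ⟨t, ht'⟩) x) from rfl, map_neg,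
      neg_apply, smul_neg, neg_one_smul, neg_add_rev]
  have hcontc : Continuous fun t : ℝ => c (Set.projIcc 0 1 zero_le_one t) :=
    c.continuous.comp continuous_projIcc
  have hcont2 : Continuous fun t : ℝ => (A (c (Set.projIcc 0 1 zero_le_one t)) ξ +
        A' (c (Set.projIcc 0 1 zero_le_one t))
          (rayPath X Y ((ξ, A q.1 ξ), w) (Set.projIcc 0 1 zero_le_one t)) x) := by
    have h1 : Continuous fun t : ℝ => A (c (Set.projIcc 0 1 zero_le_one t)) :=
      A.continuous.comp hcontc
    have h2 : Continuous fun t : ℝ => A' (c (Set.projIcc 0 1 zero_le_one t)) :=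
      A'.continuous.comp hcontc
    have h3 : Continuous fun t : ℝ =>
        rayPath X Y ((ξ, A q.1 ξ), w) (Set.projIcc 0 1 zero_le_one t) :=
      (rayPath X Y ((ξ, A q.1 ξ), w)).continuous.comp continuous_projIcc
    exact (h1.clm_apply continuous_const).add ((h2.clm_apply h3).clm_apply continuous_const)
  have hI := intervalIntegral.integral_eq_sub_of_hasDerivAt hint
    (hcont2.neg.intervalIntegrable _ _)
  rw [intervalIntegral.integral_neg] at hI
  have hW0 : W 0 = A q.1 ξ := by
    have : ce 0 = q.1 := by simp [hce, hg, hx]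
    simp [hW, this]
  have hI' : (∫ t in (0 : ℝ)..s, (A (c (Set.projIcc 0 1 zero_le_one t)) ξ +
        A' (c (Set.projIcc 0 1 zero_le_one t))
          (rayPath X Y ((ξ, A q.1 ξ), w) (Set.projIcc 0 1 zero_le_one t)) x)) =
      A q.1 ξ - W s := by
    rw [eq_comm, ← neg_inj, neg_sub, hI, hW0]
  change W s - A q.1 ξ + (∫ t in (0 : ℝ)..s, (A (c (Set.projIcc 0 1 zero_le_one t)) ξ +
        A' (c (Set.projIcc 0 1 zero_le_one t))
          (rayPath X Y ((ξ, A q.1 ξ), w) (Set.projIcc 0 1 zero_le_one t)) x)) = 0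
  rw [hI']
  abel

/-- Frobenius theorem for distributions that are graphs: the distribution of the spaces
`{(ξ, A q ξ)}` has a complete system of first integrals near `(0, y)` if it is involutive. -/
theorem exists_firstIntegrals_of_flat [CompleteSpace X] [CompleteSpace Y]
    (A : X × Y → X →L[ℝ] Y) (hA : ContDiff ℝ ∞ A) (y : Y)
    (hflat : ∀ᶠ q in 𝓝 ((0 : X), y), ∀ ξ ζ,
      fderiv ℝ A q (ξ, A q ξ) ζ = fderiv ℝ A q (ζ, A q ζ) ξ) :
    ∃ f : X × Y → Y, (∀ᶠ q in 𝓝 ((0 : X), y), ContDiffAt ℝ ∞ f q ∧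
      ∀ ξ, fderiv ℝ f q (ξ, A q ξ) = 0) ∧ ∀ η, fderiv ℝ f (0, y) (0, η) = η := by
  let Ac : C(X × Y, X →L[ℝ] Y) := ⟨A, hA.continuous⟩
  let A' : C(X × Y, X × Y →L[ℝ] X →L[ℝ] Y) := ⟨fderiv ℝ A, hA.continuous_fderiv (by simp)⟩
  have hA' (q) : HasFDerivAt Ac (A' q) q := (hA.differentiable (by simp) q).hasFDerivAt
  have hG := contDiff_rayMap Ac hA
  have hGd (q) : HasFDerivAt (rayMap Ac) (fderiv ℝ (rayMap Ac) q) q :=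
    (hG.differentiable (by simp) q).hasFDerivAt
  set q₀ : (X × Y) × C(unitInterval, Y) := ((0, y), constPath Y y) with hq₀
  obtain ⟨e₀, he₀⟩ := exists_equiv_fderiv_rayMap Ac hA y
  let g := hG.contDiffAt.toOpenPartialHomeomorph (rayMap Ac) he₀ (by simp)
  have hgG : (g : _ → _) = rayMap Ac := rfl
  have hsrc : q₀ ∈ g.source := ContDiffAt.mem_toOpenPartialHomeomorph_source _ _ _
  have hGq₀ : rayMap Ac q₀ = ((0, y), 0) := by
    refine Prod.ext rfl ?_
    ext s
    simp [rayMap, hq₀]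
  have hsymm₀ : g.symm ((0, y), 0) = q₀ := by
    rw [← hGq₀, ← hgG]
    exact g.left_inv hsrc
  have htgt₀ : ((0, y), 0) ∈ g.target := by
    rw [← hGq₀, ← hgG]
    exact g.map_source hsrc
  have hemb : Continuous fun p : X × Y => (p, (0 : C(unitInterval, Y))) := by fun_prop
  have hcs : ContinuousAt (fun p : X × Y => g.symm (p, 0)) (0, y) :=
    ContinuousAt.comp (f := fun p : X × Y => (p, (0 : C(unitInterval, Y))))
      (g.continuousAt_symm htgt₀) hemb.continuousAt
  -- Where the derivative of `rayMap` is invertible, the solution path depends smoothly on its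
  -- starting point, and its variation is the w for which (v, w) is sent to (v, 0).
  have hderiv (p : X × Y) (hp : (p, 0) ∈ g.target)
      (e : ((X × Y) × C(unitInterval, Y)) ≃L[ℝ] ((X × Y) × C(unitInterval, Y)))
      (he : HasFDerivAt (rayMap Ac) (e : _ →L[ℝ] _) (g.symm (p, 0))) :
      ContDiffAt ℝ ∞ (fun p : X × Y => (g.symm (p, 0)).2 1) p ∧
      ∀ v w, fderiv ℝ (rayMap Ac) (g.symm (p, 0)) (v, w) = (v, 0) →
        fderiv ℝ (fun p : X × Y => (g.symm (p, 0)).2 1) p v = w 1 := by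
    have hs : ContDiffAt ℝ ∞ g.symm (p, 0) := g.contDiffAt_symm hp he hG.contDiffAt
    have hsd : HasFDerivAt g.symm (e.symm : _ →L[ℝ] _) (p, 0) := g.hasFDerivAt_symm hp he
    let ev : (X × Y) × C(unitInterval, Y) →L[ℝ] Y :=
      (ContinuousMap.evalCLM ℝ 1).comp (ContinuousLinearMap.snd ℝ _ _)
    let em : X × Y →L[ℝ] (X × Y) × C(unitInterval, Y) := ContinuousLinearMap.inl ℝ _ _
    constructor
    · exact ev.contDiff.contDiffAt.comp p (ContDiffAt.comp p (f := em) hs em.contDiff.contDiffAt)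
    · intro v w hvw
      have h1 : HasFDerivAt (fun p : X × Y => (g.symm (p, 0)).2 1)
          (ev.comp ((e.symm : _ →L[ℝ] _).comp em)) p :=
        ev.hasFDerivAt.comp p (HasFDerivAt.comp p (f := em) hsd em.hasFDerivAt)
      rw [h1.fderiv]
      rw [he.fderiv] at hvw
      have : e.symm (v, 0) = (v, w) := by
        rw [← hvw]
        exact e.symm_apply_apply _
      change (e.symm (v, 0)).2 1 = w 1
      rw [this]
  -- The first integral is the end of the ray from p: the point where the curve in the leaf over (1
  -- - s)x meets the slice x = 0.
  refine ⟨fun p => (g.symm (p, 0)).2 1, ?_, ?_⟩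
  · have ev1 : ∀ᶠ p in 𝓝 ((0 : X), y), (p, (0 : C(unitInterval, Y))) ∈ g.target :=
      hemb.continuousAt.preimage_mem_nhds (g.open_target.mem_nhds htgt₀)
    have ev2 : ∀ᶠ p in 𝓝 ((0 : X), y), fderiv ℝ (rayMap Ac) (g.symm (p, 0)) ∈
        Set.range ((↑) : (((X × Y) × C(unitInterval, Y)) ≃L[ℝ] ((X × Y) × C(unitInterval, Y))) →
          (((X × Y) × C(unitInterval, Y)) →L[ℝ] ((X × Y) × C(unitInterval, Y)))) := by
      have hc : ContinuousAt (fun p : X × Y => fderiv ℝ (rayMap Ac) (g.symm (p, 0))) (0, y) :=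
        ContinuousAt.comp (f := fun p : X × Y => g.symm (p, 0))
          (hG.continuous_fderiv (by simp)).continuousAt hcs
      refine hc.preimage_mem_nhds ?_
      rw [hsymm₀, he₀.fderiv]
      exact ContinuousLinearEquiv.nhds e₀
    have ev3 : ∀ᶠ p in 𝓝 ((0 : X), y), ∀ s, ∀ ξ ζ,
        A' (rayPath X Y (g.symm (p, 0)) s) (ξ, Ac (rayPath X Y (g.symm (p, 0)) s) ξ) ζ =
        A' (rayPath X Y (g.symm (p, 0)) s) (ζ, Ac (rayPath X Y (g.symm (p, 0)) s) ζ) ξ := by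
      obtain ⟨O, hO, hOo, hO₀⟩ := eventually_nhds_iff.1 hflat
      -- Flatness is needed along the whole ray, not only at its start. Rays near the constant one
      -- stay in `O`, by compactness of the interval.
      have hop : IsOpen {c : C(unitInterval, X × Y) | Set.MapsTo c Set.univ O} :=
        ContinuousMap.isOpen_setOfPred_mapsTo isCompact_univ hOo
      have hc : ContinuousAt (fun p : X × Y => rayPath X Y (g.symm (p, 0))) (0, y) :=
        (rayPath X Y).continuous.continuousAt.comp hcs
      filter_upwards [hc.preimage_mem_nhds (hop.mem_nhds (by
        intro s _
        rw [hsymm₀]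
        simpa [hq₀] using hO₀))] with p hp s
      exact hO _ (hp (Set.mem_univ s))
    filter_upwards [ev1, ev2, ev3] with p h1 ⟨e, he⟩ h3
    have he' : HasFDerivAt (rayMap Ac) (e : _ →L[ℝ] _) (g.symm (p, 0)) := by
      rw [he]
      exact hGd _
    refine ⟨(hderiv p h1 e he').1, fun ξ => ?_⟩
    have hinv : rayMap Ac (g.symm (p, 0)) = (p, 0) := g.right_inv h1
    have hfst : (g.symm (p, 0)).1 = p := congrArg Prod.fst hinv
    obtain ⟨w, hw, hw'⟩ := fderiv_rayMap_eq Ac A' hA' (g.symm (p, 0)) (congrArg Prod.snd hinv) h3 ξ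
    rw [hfst] at hw'
    rw [← hw]
    exact (hderiv p h1 e he').2 _ w hw'
  · intro η
    rw [← hq₀, ← hsymm₀] at he₀
    refine ((hderiv (0, y) htgt₀ e₀ he₀).2 _ (constPath Y η) ?_).trans (constPath_apply η 1)
    rw [hsymm₀, fderiv_rayMap Ac A' hA']
    refine Prod.ext rfl ?_
    ext s
    simp [hq₀]

end Frobenius

/-! ### Casimir functions of a Poisson structure of constant rank on a vector space -/

section PoissonVectorSpace

open Filter Topology

universe u

variable {V : Type u} [NormedAddCommGroup V] [NormedSpace ℝ V] [FiniteDimensional ℝ V]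

/-- A smooth function on a neighbourhood of a point agrees near the point with a globally smooth
function. -/
lemma exists_contDiff_eventuallyEq {W : Type*} [NormedAddCommGroup W] [NormedSpace ℝ W]
    {O : Set V} (hO : IsOpen O) {A : V → W} (hA : ContDiffOn ℝ ∞ A O) {z₀ : V} (hz₀ : z₀ ∈ O) :
    ∃ A' : V → W, ContDiff ℝ ∞ A' ∧ A' =ᶠ[𝓝 z₀] A := by
  obtain ⟨δ, hδ, hball⟩ := Metric.isOpen_iff.1 hO z₀ hz₀
  let b : ContDiffBump z₀ := ⟨δ / 4, δ / 2, by positivity, by linarith⟩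
  refine ⟨fun z => b z • A z, contDiff_iff_contDiffAt.2 fun z => ?_, ?_⟩
  · by_cases hz : z ∈ O
    · exact b.contDiff.contDiffAt.smul (hA.contDiffAt (hO.mem_nhds hz))
    · have hz' : z ∉ tsupport b := by
        rw [b.tsupport_eq]
        intro h
        exact hz (hball (Metric.closedBall_subset_ball (by simp [b]; linarith) h))
      have : (fun z => b z • A z) =ᶠ[𝓝 z] fun _ => 0 := by
        filter_upwards [(isClosed_tsupport b).isOpen_compl.mem_nhds hz'] with w hw
        rw [image_eq_zero_of_notMem_tsupport hw, zero_smul]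
      exact contDiffAt_const.congr_of_eventuallyEq this
  · filter_upwards [b.eventuallyEq_one] with z hz
    simp [hz]

lemma fderiv_clm_comp_apply {V W X U : Type*} [NormedAddCommGroup V] [NormedSpace ℝ V]
    [NormedAddCommGroup W] [NormedSpace ℝ W] [NormedAddCommGroup X] [NormedSpace ℝ X]
    [NormedAddCommGroup U] [NormedSpace ℝ U] {P : V → W →L[ℝ] U} {B : V → X →L[ℝ] W} {z : V}
    (hP : DifferentiableAt ℝ P z) (hB : DifferentiableAt ℝ B z) (v : V) (ξ : X) :
    fderiv ℝ (fun z => (P z).comp (B z)) z v ξ =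
      fderiv ℝ P z v (B z ξ) + P z (fderiv ℝ B z v ξ) := by
  rw [(hP.hasFDerivAt.clm_comp hB.hasFDerivAt).fderiv]
  exact add_comm _ _

lemma fderiv_const_clm_comp_apply {V W X U : Type*} [NormedAddCommGroup V] [NormedSpace ℝ V]
    [NormedAddCommGroup W] [NormedSpace ℝ W] [NormedAddCommGroup X] [NormedSpace ℝ X]
    [NormedAddCommGroup U] [NormedSpace ℝ U] (L : W →L[ℝ] U) {B : V → X →L[ℝ] W} {z : V}
    (hB : DifferentiableAt ℝ B z) (v : V) (ξ : X) :
    fderiv ℝ (fun z => L.comp (B z)) z v ξ = L (fderiv ℝ B z v ξ) := by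
  rw [fderiv_clm_comp_apply (differentiableAt_const L) hB, fderiv_fun_const]
  simp

set_option maxHeartbeats 1000000 in
/-- Frobenius theorem for a Poisson tensor `P` of constant rank, given as a field of maps from
covectors to vectors: a covector in the kernel of `P` at a point is the differential of a
Casimir function. -/
theorem exists_casimir_of_anchor {O : Set V} (hO : IsOpen O) {z₀ : V} (hz₀ : z₀ ∈ O)
    (P : V → (V →L[ℝ] ℝ) →L[ℝ] V) (hP : ContDiffOn ℝ ∞ P O)
    (hskew : ∀ z ∈ O, ∀ α β : V →L[ℝ] ℝ, β (P z α) = - α (P z β))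
    (hinv : ∀ z ∈ O, ∀ α β : V →L[ℝ] ℝ,
      fderiv ℝ P z (P z α) β - fderiv ℝ P z (P z β) α ∈ LinearMap.range (P z).toLinearMap)
    (hrank : ∀ z ∈ O, Module.finrank ℝ (LinearMap.range (P z).toLinearMap) =
      Module.finrank ℝ (LinearMap.range (P z₀).toLinearMap))
    (l : V →L[ℝ] ℝ) (hl : P z₀ l = 0) :
    ∃ F : V → ℝ, (∀ᶠ z in 𝓝 z₀, ContDiffAt ℝ ∞ F z ∧ P z (fderiv ℝ F z) = 0) ∧
      fderiv ℝ F z₀ = l := by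
  -- The image of `P z₀` and a complement serve as the coordinates in which the images of nearby `P
  -- z` become graphs over `X`.
  let X : Submodule ℝ V := LinearMap.range (P z₀).toLinearMap
  obtain ⟨Y, hXY⟩ := Submodule.exists_isCompl X
  have : CompleteSpace X := FiniteDimensional.complete ℝ X
  have : CompleteSpace Y := FiniteDimensional.complete ℝ Y
  let e : (X × Y) ≃L[ℝ] V := (X.prodEquivOfIsCompl Y hXY).toContinuousLinearEquiv
  have he (q : X × Y) : e q = (q.1 : V) + q.2 := rfl
  let prX : V →L[ℝ] X := (ContinuousLinearMap.fst ℝ X Y).comp (e.symm : V →L[ℝ] X × Y)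
  let prY : V →L[ℝ] Y := (ContinuousLinearMap.snd ℝ X Y).comp (e.symm : V →L[ℝ] X × Y)
  have hpr (v : V) : v = e (prX v, prY v) := (e.apply_symm_apply v).symm
  have hprX (x : X) : prX x = x := by
    have : (x : V) = e (x, 0) := by simp [he]
    change (e.symm (x : V)).1 = x
    rw [this, e.symm_apply_apply]
  have hprY (x : X) : prY x = 0 := by
    have : (x : V) = e (x, 0) := by simp [he]
    change (e.symm (x : V)).2 = 0
    rw [this, e.symm_apply_apply]
  obtain ⟨σ₀, hσ₀⟩ := (P z₀).toLinearMap.rangeRestrict.exists_rightInverse_of_surjective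
    (LinearMap.range_rangeRestrict _)
  let σ : X →L[ℝ] (V →L[ℝ] ℝ) := LinearMap.toContinuousLinearMap σ₀
  have hσ (x : X) : P z₀ (σ x) = x := congrArg Subtype.val (LinearMap.congr_fun hσ₀ x)
  -- `T` is the identity at `z₀`, hence invertible nearby. Correcting the section σ by its inverse
  -- yields `H z`, a frame of the image of `P z` whose `X`-component is the identity; constant rank
  -- makes it span the whole image.
  let T : V → X →L[ℝ] X := fun z => prX.comp ((P z).comp σ)
  have hT : ContDiffOn ℝ ∞ T O := contDiffOn_const.clm_comp (hP.clm_comp contDiffOn_const)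
  have hT₀ : T z₀ = 1 := by
    ext x
    simp [T, hσ, hprX]
  let O' : Set V := O ∩ T ⁻¹' {S | IsUnit S}
  have hO' : IsOpen O' := hT.continuousOn.isOpen_inter_preimage hO
    (Units.isOpen (R := X →L[ℝ] X))
  have hz₀' : z₀ ∈ O' := ⟨hz₀, by simp [hT₀]⟩
  let B : V → X →L[ℝ] (V →L[ℝ] ℝ) := fun z => σ.comp (Ring.inverse (T z))
  have hTI : ContDiffOn ℝ ∞ (fun z => Ring.inverse (T z)) O' := by
    intro z hz
    obtain ⟨S, hS⟩ := hz.2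
    have h1 : ContDiffAt ℝ ∞ Ring.inverse (T z) := by
      rw [← hS]
      exact contDiffAt_ringInverse (R := X →L[ℝ] X) ℝ S
    exact h1.comp_contDiffWithinAt z ((hT z hz.1).mono Set.inter_subset_left)
  have hB : ContDiffOn ℝ ∞ B O' := contDiffOn_const.clm_comp hTI
  let H : V → X →L[ℝ] V := fun z => (P z).comp (B z)
  have hH : ContDiffOn ℝ ∞ H O' := (hP.mono Set.inter_subset_left).clm_comp hB
  let A : V → X →L[ℝ] Y := fun z => prY.comp (H z)
  have hA : ContDiffOn ℝ ∞ A O' := contDiffOn_const.clm_comp hH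
  have hHX (z : V) (hz : z ∈ O') : prX.comp (H z) = 1 := by
    have : T z * Ring.inverse (T z) = 1 := Ring.mul_inverse_cancel _ hz.2
    exact this
  have hHA (z : V) (hz : z ∈ O') (ξ : X) : H z ξ = e (ξ, A z ξ) := by
    have h1 : prX (H z ξ) = ξ := congrArg (fun S : X →L[ℝ] X => S ξ) (hHX z hz)
    conv_lhs => rw [hpr (H z ξ), h1]
    rfl
  have hgraph (z : V) (hz : z ∈ O') (v : V) (hv : v ∈ LinearMap.range (P z).toLinearMap) :
      v = e (prX v, A z (prX v)) := by
    have hinj : Function.Injective (H z).toLinearMap := by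
      intro ξ ζ h
      have := congrArg prX h
      have h1 (ξ : X) : prX (H z ξ) = ξ := congrArg (fun S : X →L[ℝ] X => S ξ) (hHX z hz)
      simpa [h1] using! this
    have hle : LinearMap.range (H z).toLinearMap ≤ LinearMap.range (P z).toLinearMap := by
      rintro _ ⟨ξ, rfl⟩
      exact ⟨B z ξ, rfl⟩
    have heq := Submodule.eq_of_le_of_finrank_eq hle (by
      rw [LinearMap.finrank_range_of_inj hinj, hrank z hz.1])
    rw [← heq] at hv
    obtain ⟨ξ, rfl⟩ := hv
    have h1 : prX (H z ξ) = ξ := congrArg (fun S : X →L[ℝ] X => S ξ) (hHX z hz)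
    change H z ξ = e (prX (H z ξ), A z (prX (H z ξ)))
    rw [h1]
    exact hHA z hz ξ
  have hflat (z : V) (hz : z ∈ O') (ξ ζ : X) :
      fderiv ℝ A z (H z ξ) ζ = fderiv ℝ A z (H z ζ) ξ := by
    have hzn : O' ∈ 𝓝 z := hO'.mem_nhds hz
    have dP : DifferentiableAt ℝ P z :=
      (hP.contDiffAt (hO.mem_nhds hz.1)).differentiableAt (by simp)
    have dB : DifferentiableAt ℝ B z := (hB.contDiffAt hzn).differentiableAt (by simp)
    have dH : DifferentiableAt ℝ H z := (hH.contDiffAt hzn).differentiableAt (by simp)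
    have hHf (v : V) (ξ : X) :
        fderiv ℝ H z v ξ = fderiv ℝ P z v (B z ξ) + P z (fderiv ℝ B z v ξ) :=
      fderiv_clm_comp_apply dP dB v ξ
    have hX0 (v : V) (ξ : X) : prX (fderiv ℝ H z v ξ) = 0 := by
      have h2 : (fun z => prX.comp (H z)) =ᶠ[𝓝 z] fun _ => 1 := by
        filter_upwards [hzn] with w hw using hHX w hw
      rw [← fderiv_const_clm_comp_apply prX dH, h2.fderiv_eq, fderiv_fun_const]
      rfl
    have hYA (v : V) (ξ : X) : prY (fderiv ℝ H z v ξ) = fderiv ℝ A z v ξ :=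
      (fderiv_const_clm_comp_apply prY dH v ξ).symm
    -- This is the commutator of two frame fields. Involutivity puts it in the image of `P z`, while
    -- its `X`-component vanishes because that of `H` is constant; a graph contains no nonzero such
    -- vector.
    have hmem : fderiv ℝ H z (H z ξ) ζ - fderiv ℝ H z (H z ζ) ξ ∈
        LinearMap.range (P z).toLinearMap := by
      rw [hHf, hHf, add_sub_add_comm]
      refine Submodule.add_mem _ (hinv z hz.1 (B z ξ) (B z ζ)) ?_
      rw [← map_sub]
      exact ⟨_, rfl⟩
    have h0 := hgraph z hz _ hmem
    rw [map_sub, hX0, hX0, sub_zero, map_zero, Prod.mk_zero_zero, map_zero] at h0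
    have h1 := congrArg prY h0
    rw [map_sub, hYA, hYA, map_zero, sub_eq_zero] at h1
    exact h1
  have hA₀ (ξ : X) : A z₀ ξ = 0 := by
    obtain ⟨α, hα⟩ : H z₀ ξ ∈ LinearMap.range (P z₀).toLinearMap := ⟨B z₀ ξ, rfl⟩
    exact hprY ⟨H z₀ ξ, ⟨α, hα⟩⟩
  obtain ⟨A₁, hA₁, hA₁A⟩ := exists_contDiff_eventuallyEq hO' hA hz₀'
  let τ : X × Y → V := fun q => z₀ + e q
  have hτ : ContDiff ℝ ∞ τ := contDiff_const.add e.contDiff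
  have hτd (q : X × Y) : HasFDerivAt τ (e : X × Y →L[ℝ] V) q :=
    (e : X × Y →L[ℝ] V).hasFDerivAt.const_add z₀
  have hτ₀ : τ (0, 0) = z₀ := by simp [τ]
  have hτc : Tendsto τ (𝓝 (0, 0)) (𝓝 z₀) := by
    have := hτ.continuous.tendsto (0, 0)
    rwa [hτ₀] at this
  obtain ⟨f, hf, hf₀⟩ := exists_firstIntegrals_of_flat (fun q => A₁ (τ q)) (hA₁.comp hτ) 0 (by
    filter_upwards [hτc.eventually hA₁A.eventually_nhds, hτc.eventually (hO'.mem_nhds hz₀')]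
      with q hq hqO ξ ζ
    have h1 : HasFDerivAt (fun q => A₁ (τ q)) _ q :=
      ((hA₁.differentiable (by simp) (τ q)).hasFDerivAt.comp q (hτd q))
    have h2 : A₁ (τ q) = A (τ q) := hq.self_of_nhds
    have h3 (ξ : X) : e (ξ, A (τ q) ξ) = H (τ q) ξ := (hHA _ hqO ξ).symm
    rw [h1.fderiv, h2, Filter.EventuallyEq.fderiv_eq hq]
    simp only [ContinuousLinearMap.comp_apply, ContinuousLinearEquiv.coe_coe, h3]
    exact hflat _ hqO ξ ζ)
  let κ : V → X × Y := fun z => e.symm (z - z₀)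
  have hκ : ContDiff ℝ ∞ κ := e.symm.contDiff.comp (contDiff_id.sub contDiff_const)
  have hκd (z : V) : HasFDerivAt κ (e.symm : V →L[ℝ] X × Y) z :=
    (e.symm : V →L[ℝ] X × Y).hasFDerivAt.comp z ((hasFDerivAt_id z).sub_const z₀)
  have hκ₀ : κ z₀ = (0, 0) := by
    change e.symm (z₀ - z₀) = 0
    rw [sub_self, map_zero]
  have hτκ (z : V) : τ (κ z) = z := by simp [τ, κ]
  have hκc : Tendsto κ (𝓝 z₀) (𝓝 (0, 0)) := by
    have := hκ.continuous.tendsto z₀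
    rwa [hκ₀] at this
  -- Only the restriction of `l` to `Y` matters: by skewness, `l` vanishes on the image of `P z₀`.
  let lY : Y →L[ℝ] ℝ := l.comp Y.subtypeL
  have hF (z : V) (h : ContDiffAt ℝ ∞ f (κ z)) (v : V) :
      fderiv ℝ (fun z => lY (f (κ z))) z v = lY (fderiv ℝ f (κ z) (e.symm v)) := by
    have h1 : HasFDerivAt (fun z => lY (f (κ z))) _ z := lY.hasFDerivAt.comp z
      ((h.differentiableAt (by simp)).hasFDerivAt.comp z (hκd z))
    rw [h1.fderiv]
    rfl
  refine ⟨fun z => lY (f (κ z)), ?_, ?_⟩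
  · filter_upwards [hκc.eventually hf, hA₁A, hO'.mem_nhds hz₀'] with z hz hzA hzO
    refine ⟨lY.contDiff.contDiffAt.comp z (hz.1.comp z hκ.contDiffAt), ?_⟩
    -- By skewness, β(P dF) = -dF(Pβ), and `Pβ` lies in the distribution, on which dF is zero.
    by_contra hne
    obtain ⟨β, hβ⟩ := SeparatingDual.exists_ne_zero (R := ℝ) hne
    apply hβ
    rw [hskew z hzO.1, neg_eq_zero, hF z hz.1]
    have h1 := hgraph z hzO (P z β) ⟨β, rfl⟩
    rw [h1, e.symm_apply_apply]
    have h2 := hz.2 (prX (P z β))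
    rw [hτκ, hzA] at h2
    rw [h2, map_zero]
  · ext v
    have h0 := hf.self_of_nhds
    rw [hF z₀ (by rw [hκ₀]; exact h0.1), hκ₀]
    have h1 : e.symm v = (prX v, A₁ z₀ (prX v)) + (0, prY v) := by
      rw [hA₁A.self_of_nhds, hA₀]
      apply e.injective
      rw [e.apply_symm_apply]
      simpa using hpr v
    have h2 := h0.2 (prX v)
    rw [hτ₀] at h2
    rw [h1, map_add, h2, hf₀, zero_add]
    have h3 : l (prX v : V) = 0 := by
      obtain ⟨α, hα⟩ := (prX v).2
      rw [← hα]
      change l (P z₀ α) = 0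
      rw [hskew z₀ hz₀, hl, map_zero, neg_zero]
    conv_rhs => rw [hpr v, he, map_add, h3, zero_add]
    rfl

end PoissonVectorSpace

/-! ### Invariance of the rank under surjective pull-back -/

section Rank

lemma formRank_compl₁₂ {K V W : Type*} [Field K] [AddCommGroup V] [Module K V] [AddCommGroup W]
    [Module K W] (B : LinearMap.BilinForm K V) {f : W →ₗ[K] V} (hf : Function.Surjective f) :
    formRank (B.compl₁₂ f f : LinearMap.BilinForm K W) = formRank B := by
  have h : (B.compl₁₂ f f : LinearMap.BilinForm K W) = f.dualMap ∘ₗ B ∘ₗ f := rfl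
  rw [formRank, formRank, h, LinearMap.range_comp, LinearMap.range_comp_of_range_eq_top _
    (LinearMap.range_eq_top.2 hf)]
  exact (Submodule.equivMapOfInjective _
    (LinearMap.dualMap_injective_of_surjective hf) _).finrank_eq.symm

end Rank

/-! ### Poisson tensors on a vector space and their anchor maps -/

section PoissonVectorSpace

open Filter Topology

universe u

variable {V : Type u} [NormedAddCommGroup V] [NormedSpace ℝ V] [FiniteDimensional ℝ V]

/-- The linear map from covectors to vectors given by a bilinear form on covectors. -/
def anchor (B : LinearMap.BilinForm ℝ (Module.Dual ℝ V)) : (V →L[ℝ] ℝ) →L[ℝ] V :=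
  LinearMap.toContinuousLinearMap ((Module.evalEquiv ℝ V).symm.toLinearMap ∘ₗ B ∘ₗ
    (LinearMap.toContinuousLinearMap (𝕜 := ℝ) (E := V) (F' := ℝ)).symm.toLinearMap)

lemma apply_anchor (B : LinearMap.BilinForm ℝ (Module.Dual ℝ V)) (α : V →L[ℝ] ℝ)
    (β : Module.Dual ℝ V) : β (anchor B α) = B α.toLinearMap β :=
  Module.apply_evalEquiv_symm_apply ℝ V β (B α.toLinearMap)

lemma finrank_range_anchor (B : LinearMap.BilinForm ℝ (Module.Dual ℝ V)) :
    Module.finrank ℝ (LinearMap.range (anchor B).toLinearMap) = formRank B := by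
  have h : (anchor B).toLinearMap = (Module.evalEquiv ℝ V).symm.toLinearMap ∘ₗ B ∘ₗ
    (LinearMap.toContinuousLinearMap (𝕜 := ℝ) (E := V) (F' := ℝ)).symm.toLinearMap := rfl
  rw [h, LinearMap.range_comp, LinearMap.range_comp_of_range_eq_top _ (LinearEquiv.range _)]
  exact LinearEquiv.finrank_map_eq (Module.evalEquiv ℝ V).symm _

lemma anchor_eq_zero (B : LinearMap.BilinForm ℝ (Module.Dual ℝ V)) (α : V →L[ℝ] ℝ) :
    anchor B α = 0 ↔ B α.toLinearMap = 0 := by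
  rw [← Module.forall_dual_apply_eq_zero_iff ℝ (anchor B α)]
  simp_rw [apply_anchor]
  exact (LinearMap.ext_iff (f := B α.toLinearMap) (g := 0)).symm

lemma contDiffOn_anchor {O : Set V} {π : V → LinearMap.BilinForm ℝ (Module.Dual ℝ V)}
    (hπ : ∀ α β, ContDiffOn ℝ ∞ (fun z => π z α β) O) :
    ContDiffOn ℝ ∞ (fun z => anchor (π z)) O := by
  refine contDiffOn_clm_apply.2 fun α => ?_
  let b := Module.finBasis ℝ V
  rw [← b.equivFunL.comp_contDiffOn_iff]
  refine contDiffOn_pi.2 fun i => ?_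
  convert! hπ α.toLinearMap (b.coord i) using 2 with z
  exact apply_anchor (π z) α (b.coord i)

/-- On a vector space, a covector in the kernel of a Poisson tensor of constant rank is the
differential of a Casimir function. -/
theorem exists_casimir_vectorSpace {O : Set V} (hO : IsOpen O) {z₀ : V} (hz₀ : z₀ ∈ O)
    (π : V → LinearMap.BilinForm ℝ (Module.Dual ℝ V)) (halt : ∀ z ∈ O, (π z).IsAlt)
    (hπ : ∀ α β, ContDiffOn ℝ ∞ (fun z => π z α β) O)
    (hjac : ∀ z ∈ O, ∀ α β γ, π z α (fderiv ℝ (fun z => π z β γ) z).toLinearMap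
      + π z β (fderiv ℝ (fun z => π z γ α) z).toLinearMap
      + π z γ (fderiv ℝ (fun z => π z α β) z).toLinearMap = 0)
    (hrank : ∀ z ∈ O, formRank (π z) = formRank (π z₀))
    (l : V →L[ℝ] ℝ) (hl : π z₀ l.toLinearMap = 0) :
    ∃ F : V → ℝ, (∀ᶠ z in 𝓝 z₀, ContDiffAt ℝ ∞ F z ∧ π z (fderiv ℝ F z).toLinearMap = 0) ∧
      fderiv ℝ F z₀ = l := by
  have hP := contDiffOn_anchor hπ
  have hskew : ∀ z ∈ O, ∀ α β : V →L[ℝ] ℝ,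
      β (anchor (π z) α) = - α (anchor (π z) β) := by
    intro z hz α β
    have h1 := apply_anchor (π z) α β.toLinearMap
    have h2 := apply_anchor (π z) β α.toLinearMap
    rw [← (halt z hz).neg_eq, ← h2] at h1
    exact h1
  have hinv : ∀ z ∈ O, ∀ α β : V →L[ℝ] ℝ,
      fderiv ℝ (fun z => anchor (π z)) z (anchor (π z) α) β -
        fderiv ℝ (fun z => anchor (π z)) z (anchor (π z) β) α ∈
          LinearMap.range (anchor (π z)).toLinearMap := by
    intro z hz α β
    have hd : DifferentiableAt ℝ (fun z => anchor (π z)) z :=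
      (hP.contDiffAt (hO.mem_nhds hz)).differentiableAt (by simp)
    have key (α : V →L[ℝ] ℝ) (γ : Module.Dual ℝ V) (v : V) :
        γ (fderiv ℝ (fun z => anchor (π z)) z v α) =
          fderiv ℝ (fun z => π z α.toLinearMap γ) z v := by
      let γ' : V →L[ℝ] ℝ := LinearMap.toContinuousLinearMap γ
      have h1 : HasFDerivAt (fun z => γ' (anchor (π z) α)) _ z :=
        γ'.hasFDerivAt.comp z (hd.hasFDerivAt.clm_apply (hasFDerivAt_const α z))
      have h2 : (fun z => γ' (anchor (π z) α)) = fun z => π z α.toLinearMap γ := by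
        ext z
        exact apply_anchor (π z) α γ
      rw [h2] at h1
      rw [h1.fderiv]
      simp [γ']
    -- For constant covectors, the commutator of the Hamiltonian fields of α and β is the
    -- Hamiltonian field of π(α, β). This is the Jacobi identity paired with an arbitrary γ.
    refine ⟨fderiv ℝ (fun z => π z α.toLinearMap β.toLinearMap) z, ?_⟩
    refine Eq.symm (sub_eq_zero.1 ((Module.forall_dual_apply_eq_zero_iff ℝ _).1 fun γ => ?_))
    rw [map_sub, map_sub, key, key]
    change _ - γ (anchor (π z) _) = 0
    rw [apply_anchor, ← (halt z hz).neg_eq]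
    have hJ := hjac z hz α.toLinearMap β.toLinearMap γ
    have e1 (α : V →L[ℝ] ℝ) (d : V →L[ℝ] ℝ) :
        π z α.toLinearMap d.toLinearMap = d (anchor (π z) α) :=
      (apply_anchor (π z) α d.toLinearMap).symm
    have e2 : fderiv ℝ (fun z => π z γ α.toLinearMap) z =
        - fderiv ℝ (fun z => π z α.toLinearMap γ) z := by
      rw [← fderiv_fun_neg]
      apply Filter.EventuallyEq.fderiv_eq
      filter_upwards [hO.mem_nhds hz] with w hw
      exact ((halt w hw).neg_eq _ _).symm
    rw [e2, e1, e1] at hJ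
    rw [neg_apply] at hJ
    linarith
  obtain ⟨F, hF, hF₀⟩ := exists_casimir_of_anchor hO hz₀ (fun z => anchor (π z)) hP hskew hinv
    (by simpa only [finrank_range_anchor] using hrank) l ((anchor_eq_zero _ _).2 hl)
  refine ⟨F, ?_, hF₀⟩
  filter_upwards [hF] with z hz
  exact ⟨hz.1, (anchor_eq_zero _ _).1 hz.2⟩

end PoissonVectorSpace

/-! ### Casimir functions on manifolds -/

section PoissonManifold

open Filter Topology

universe u

variable {F : Type u} [NormedAddCommGroup F] [NormedSpace ℝ F]
  {N : Type*} [TopologicalSpace N] [ChartedSpace F N]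

/-- The differential at `q` of the preferred chart at `x`. -/
def chartDifferential (F : Type*) [NormedAddCommGroup F] [NormedSpace ℝ F]
    {N : Type*} [TopologicalSpace N] [ChartedSpace F N] (x q : N) : F →L[ℝ] F :=
  mfderiv 𝓘(ℝ, F) 𝓘(ℝ, F) (chartAt F x) q

section

variable [IsManifold 𝓘(ℝ, F) ∞ N]

lemma chartDifferential_bijective {x q : N} (hq : q ∈ (chartAt F x).source) :
    Function.Bijective (chartDifferential F x q) := by
  have : IsManifold 𝓘(ℝ, F) 1 N := IsManifold.of_le (n := ∞) (by simp)
  exact (mdifferentiable_chart (I := 𝓘(ℝ, F)) x).mfderiv_bijective hq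

lemma differential_comp_chart {x q : N} (hq : q ∈ (chartAt F x).source) {G : F → ℝ}
    (hG : DifferentiableAt ℝ G (chartAt F x q)) :
    differential (F := F) (fun y => G (chartAt F x y)) q =
      (chartDifferential F x q).toLinearMap.dualMap
        (fderiv ℝ G (chartAt F x q)).toLinearMap := by
  have : IsManifold 𝓘(ℝ, F) 1 N := IsManifold.of_le (n := ∞) (by simp)
  have h1 : MDifferentiableAt 𝓘(ℝ, F) 𝓘(ℝ, F) (chartAt F x) q :=
    mdifferentiableAt_atlas (chart_mem_atlas F x) hq
  have h2 := mfderiv_comp (I := 𝓘(ℝ, F)) (I' := 𝓘(ℝ, F)) (I'' := 𝓘(ℝ, ℝ)) q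
    hG.mdifferentiableAt h1
  rw [mfderiv_eq_fderiv] at h2
  exact congrArg (fun L : F →L[ℝ] ℝ => L.toLinearMap) h2

lemma contMDiffOn_chartAt (x : N) :
    ContMDiffOn 𝓘(ℝ, F) 𝓘(ℝ, F) ∞ (chartAt F x) (chartAt F x).source :=
  contMDiffOn_chart

variable [FiniteDimensional ℝ F]

/-- The linear coordinate functions of a chart. -/
lemma smoothOn_coordinate (x : N) (α : Module.Dual ℝ F) :
    SmoothOn F (fun y => α (chartAt F x y)) (chartAt F x).source :=
  (LinearMap.toContinuousLinearMap α).contMDiff.comp_contMDiffOn (contMDiffOn_chartAt x)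

lemma differential_coordinate {x q : N} (hq : q ∈ (chartAt F x).source) (α : Module.Dual ℝ F) :
    differential (F := F) (fun y => α (chartAt F x y)) q =
      (chartDifferential F x q).toLinearMap.dualMap α := by
  have h := differential_comp_chart hq (LinearMap.toContinuousLinearMap α).differentiableAt
  rw [ContinuousLinearMap.fderiv] at h
  exact h

/-- A tensor field expressed in the preferred chart at `x`. -/
def chartTensor (c : TensorField F N) (x : N) (z : F) :
    LinearMap.BilinForm ℝ (Module.Dual ℝ F) :=
  (c ((chartAt F x).symm z)).compl₁₂
    (chartDifferential F x ((chartAt F x).symm z)).toLinearMap.dualMap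
    (chartDifferential F x ((chartAt F x).symm z)).toLinearMap.dualMap

lemma dualMap_chartDifferential_surjective {x q : N} (hq : q ∈ (chartAt F x).source) :
    Function.Surjective (chartDifferential F x q).toLinearMap.dualMap :=
  LinearMap.dualMap_surjective_of_injective (chartDifferential_bijective hq).1

lemma formRank_chartTensor (c : TensorField F N) {x : N} {z : F}
    (hz : z ∈ (chartAt F x).target) :
    formRank (chartTensor c x z) = formRank (c ((chartAt F x).symm z)) :=
  formRank_compl₁₂ _ (dualMap_chartDifferential_surjective ((chartAt F x).map_target hz))

lemma chartTensor_apply (c : TensorField F N) {x : N} {z : F}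
    (hz : z ∈ (chartAt F x).target) (α β : Module.Dual ℝ F) :
    chartTensor c x z α β = bracket c (fun y => α (chartAt F x y))
      (fun y => β (chartAt F x y)) ((chartAt F x).symm z) := by
  have hq := (chartAt F x).map_target hz
  rw [bracket, differential_coordinate hq, differential_coordinate hq]
  rfl

lemma contDiffOn_chartTensor {c : TensorField F N} (hc : IsPoisson c) (x : N)
    (α β : Module.Dual ℝ F) :
    ContDiffOn ℝ ∞ (fun z => chartTensor c x z α β) (chartAt F x).target := by
  have h1 := hc.smooth _ (chartAt F x).open_source _ _ (smoothOn_coordinate x α)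
    (smoothOn_coordinate x β)
  have h2 := h1.comp (contMDiffOn_chart_symm (I := 𝓘(ℝ, F)) (x := x))
    (fun z hz => (chartAt F x).map_target hz)
  exact h2.contDiffOn.congr fun z hz => chartTensor_apply c hz α β

/-- A covector in the kernel of a Poisson bivector field of locally constant rank is the
differential of a local Casimir function. -/
theorem exists_casimir {c : TensorField F N} (hc : IsPoisson c) {x : N}
    (hrank : ∀ᶠ q in 𝓝 x, formRank (c q) = formRank (c x)) (ξ : Module.Dual ℝ F)
    (hξ : c x ξ = 0) :
    ∃ U : Set N, IsOpen U ∧ x ∈ U ∧ ∃ f : N → ℝ, IsCasimirOn c U f ∧ differential f x = ξ := by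
  obtain ⟨W, hW, hWo, hxW⟩ := eventually_nhds_iff.1 hrank
  set φ := chartAt F x with hφ
  have hx : x ∈ φ.source := mem_chart_source F x
  let O : Set F := φ.target ∩ φ.symm ⁻¹' W
  have hO : IsOpen O := φ.isOpen_inter_preimage_symm hWo
  have hx' : φ.symm (φ x) = x := φ.left_inv hx
  have hz₀ : φ x ∈ O := ⟨φ.map_source hx, by simpa [hx'] using hxW⟩
  have hjac : ∀ z ∈ O, ∀ α β γ,
      chartTensor c x z α (fderiv ℝ (fun z => chartTensor c x z β γ) z).toLinearMap
      + chartTensor c x z β (fderiv ℝ (fun z => chartTensor c x z γ α) z).toLinearMap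
      + chartTensor c x z γ (fderiv ℝ (fun z => chartTensor c x z α β) z).toLinearMap = 0 := by
    intro z hz α β γ
    have hq := φ.map_target hz.1
    have hr : φ (φ.symm z) = z := φ.right_inv hz.1
    have key (α β γ : Module.Dual ℝ F) :
        bracket c (fun y => α (φ y)) (bracket c (fun y => β (φ y)) (fun y => γ (φ y)))
          (φ.symm z) =
        chartTensor c x z α (fderiv ℝ (fun z => chartTensor c x z β γ) z).toLinearMap := by
      have hd : DifferentiableAt ℝ (fun z => chartTensor c x z β γ) (φ (φ.symm z)) := by
        rw [hr]
        exact ((contDiffOn_chartTensor hc x β γ).contDiffAt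
          (φ.open_target.mem_nhds hz.1)).differentiableAt (by simp)
      have h1 := differential_comp_chart hq hd
      have h2 : bracket c (fun y => β (φ y)) (fun y => γ (φ y)) =ᶠ[𝓝 (φ.symm z)]
          fun y => chartTensor c x (φ y) β γ := by
        filter_upwards [φ.open_source.mem_nhds hq] with y hy
        rw [chartTensor_apply c (φ.map_source hy), ← hφ, φ.left_inv hy]
      have h3 : differential (F := F) (bracket c (fun y => β (φ y)) (fun y => γ (φ y)))
          (φ.symm z) = differential (fun y => chartTensor c x (φ y) β γ) (φ.symm z) :=
        congrArg (fun L : F →L[ℝ] ℝ => L.toLinearMap) (Filter.EventuallyEq.mfderiv_eq h2)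
      rw [bracket, h3, h1, differential_coordinate hq]
      rw [← hφ, hr]
      rfl
    -- The Jacobi identity is used only for the linear coordinate functions of the chart, whose
    -- brackets are the components of the tensor there.
    have h := hc.jacobi _ φ.open_source _ _ _ (smoothOn_coordinate x α)
      (smoothOn_coordinate x β) (smoothOn_coordinate x γ) _ hq
    rwa [key, key, key] at h
  obtain ⟨l₀, hl₀⟩ := dualMap_chartDifferential_surjective hx ξ
  let l : F →L[ℝ] ℝ := LinearMap.toContinuousLinearMap l₀
  have hl : (chartDifferential F x x).toLinearMap.dualMap l.toLinearMap = ξ := hl₀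
  obtain ⟨G, hG, hG₀⟩ := exists_casimir_vectorSpace hO hz₀ (chartTensor c x)
    (fun z _ α => hc.alternating _ _)
    (fun α β => (contDiffOn_chartTensor hc x α β).mono Set.inter_subset_left) hjac
    (fun z hz => by
      rw [formRank_chartTensor c hz.1, formRank_chartTensor c hz₀.1, hW _ hz.2, ← hφ, hx'])
    l (by
      ext β
      change c (φ.symm (φ x)) ((chartDifferential F x (φ.symm (φ x))).toLinearMap.dualMap
        l.toLinearMap) _ = 0
      rw [hx', hl, hξ]
      rfl)
  obtain ⟨S, hS, hSo, hxS⟩ := eventually_nhds_iff.1 hG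
  refine ⟨φ.source ∩ φ ⁻¹' S, φ.isOpen_inter_preimage hSo, ⟨hx, hxS⟩, fun y => G (φ y), ⟨?_, ?_⟩, ?_⟩
  · have h1 : ContDiffOn ℝ ∞ G S := fun z hz => (hS z hz).1.contDiffWithinAt
    exact h1.contMDiffOn.comp ((contMDiffOn_chartAt x).mono Set.inter_subset_left)
      (fun y hy => hy.2)
  · intro y hy
    have h1 := hS _ hy.2
    rw [differential_comp_chart hy.1 (h1.1.differentiableAt (by simp))]
    refine LinearMap.ext fun β => ?_
    obtain ⟨β', rfl⟩ := dualMap_chartDifferential_surjective hy.1 β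
    have h2 := LinearMap.congr_fun h1.2 β'
    have h3 : φ.symm (φ y) = y := φ.left_inv hy.1
    change c (φ.symm (φ y)) ((chartDifferential F x (φ.symm (φ y))).toLinearMap.dualMap _)
      ((chartDifferential F x (φ.symm (φ y))).toLinearMap.dualMap β') = 0 at h2
    rwa [h3] at h2
  · rw [differential_comp_chart hx ((hS _ hxS).1.differentiableAt (by simp)), ← hφ, hG₀, hl]

end

end PoissonManifold

/-! ### Pencils of alternating forms of constant rank -/

section Pencil

open Module

variable {K V W : Type*} [Field K] [AddCommGroup V] [Module K V] [FiniteDimensional K V]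
  [AddCommGroup W] [Module K W]

/-- The rank of a linear pencil is lower semicontinuous: if it is at most `r` for infinitely many
parameters, then it is at most `r` everywhere. -/
lemma finrank_range_le_of_infinite (A B : V →ₗ[K] W) {r : ℕ} {T : Set K} (hT : T.Infinite)
    (h : ∀ t ∈ T, finrank K (LinearMap.range (A + t • B)) ≤ r) :
    finrank K (LinearMap.range A) ≤ r := by
  obtain ⟨i, hi⟩ := A.rangeRestrict.exists_rightInverse_of_surjective (LinearMap.range_rangeRestrict A)
  obtain ⟨j, hj⟩ := (LinearMap.range A).subtype.exists_leftInverse_of_injective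
    (Submodule.ker_subtype _)
  -- On the range of `A`, the member `A + t • B` is compressed to 1 + tC. This is injective unless
  -- -1/t is an eigenvalue of `C`, which excludes finitely many t.
  let C : End K (LinearMap.range A) := j ∘ₗ B ∘ₗ i
  have hA (v : LinearMap.range A) : j (A (i v)) = v := by
    have h1 : A (i v) = v := congrArg Subtype.val (LinearMap.congr_fun hi v)
    rw [h1]
    exact LinearMap.congr_fun hj v
  have hfin : Set.Finite ((fun t : K => -t⁻¹) ⁻¹' {μ | C.HasEigenvalue μ}) :=
    C.finite_hasEigenvalue.preimage fun a _ b _ hab => inv_injective (neg_injective hab)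
  obtain ⟨t, htT, ht⟩ := hT.exists_notMem_finite hfin
  refine le_trans ?_ (h t htT)
  have hinj : Function.Injective ((A + t • B) ∘ₗ i) := by
    rw [← LinearMap.ker_eq_bot, LinearMap.ker_eq_bot']
    intro v hv
    have h1 : v + t • C v = 0 := by
      have := congrArg j hv
      simpa [hA, C] using this
    by_contra hne
    apply ht
    have ht0 : t ≠ 0 := by
      rintro rfl
      exact hne (by simpa using h1)
    refine Module.End.hasEigenvalue_of_hasEigenvector (x := v)
      ⟨Module.End.mem_eigenspace_iff.2 ?_, hne⟩
    have h2 : t • C v = -v := by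
      rw [eq_neg_iff_add_eq_zero, add_comm]
      exact h1
    have h3 : C v = t⁻¹ • (t • C v) := by rw [smul_smul, inv_mul_cancel₀ ht0, one_smul]
    rw [h3, h2, smul_neg, neg_smul]
  rw [← LinearMap.finrank_range_of_inj hinj, LinearMap.range_comp]
  exact Submodule.finrank_mono (LinearMap.map_le_range)

/-- In a linear pencil, a kernel of minimal dimension is contained in the span of the kernels of
infinitely many members. -/
lemma ker_le_iSup_ker (A B : V →ₗ[K] W) {T : Set K} (hT : T.Infinite)
    (h : ∀ t ∈ T, finrank K (LinearMap.range (A + t • B)) ≤ finrank K (LinearMap.range A)) :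
    LinearMap.ker A ≤ ⨆ t ∈ T, LinearMap.ker (A + t • B) := by
  intro v hv
  by_contra hne
  obtain ⟨l, hlv, hl⟩ := Submodule.exists_le_ker_of_notMem hne
  have hker (t : K) (ht : t ∈ T) : LinearMap.ker (A + t • B) ≤ LinearMap.ker l :=
    (le_iSup₂_of_le t ht le_rfl).trans hl
  -- Adjoining `l` as an extra row leaves the kernels for t in `T` unchanged but would shrink the
  -- kernel of `A`. The rank at t = 0 would then exceed the rank at infinitely many parameters,
  -- against semicontinuity.
  have hprod (t : K) : A.prod l + t • B.prod 0 = (A + t • B).prod l := by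
    ext v <;> simp
  have hrank := finrank_range_le_of_infinite (A.prod l) (B.prod (0 : V →ₗ[K] K)) hT
    (r := finrank K (LinearMap.range A)) (by
      intro t ht
      refine le_trans (le_of_eq ?_) (h t ht)
      have h1 := LinearMap.finrank_range_add_finrank_ker (A + t • B)
      have h2 := LinearMap.finrank_range_add_finrank_ker ((A + t • B).prod l)
      rw [LinearMap.ker_prod, inf_eq_left.2 (hker t ht)] at h2
      rw [hprod]
      omega)
  have h1 := LinearMap.finrank_range_add_finrank_ker A
  have h2 := LinearMap.finrank_range_add_finrank_ker (A.prod l)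
  rw [LinearMap.ker_prod] at h2
  have h3 : LinearMap.ker A ⊓ LinearMap.ker l = LinearMap.ker A :=
    Submodule.eq_of_le_of_finrank_le inf_le_left (by omega)
  exact hlv (LinearMap.mem_ker.1 (inf_eq_left.1 h3 hv))

end Pencil

/-! ### The core of a pencil of alternating forms -/

section AlternatingPencil

open Module

variable {V : Type*} [AddCommGroup V] [Module ℂ V] [FiniteDimensional ℂ V]

/-- The span of the kernels of the members `a + t b` of a pencil, where `t` is a nonzero real
number. -/
def pencilCore (a b : LinearMap.BilinForm ℂ V) : Submodule ℂ V :=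
  ⨆ t ∈ {t : ℂ | t ≠ 0 ∧ ∃ r : ℝ, (r : ℂ) = t}, LinearMap.ker (a + t • b)

lemma infinite_pencilParameters (S : Set ℂ) (hS : S.Finite) :
    ({t : ℂ | t ≠ 0 ∧ ∃ r : ℝ, (r : ℂ) = t} \ S).Infinite := by
  refine Set.Infinite.sdiff ?_ hS
  have h : Set.Infinite ((fun r : ℝ => (r : ℂ)) '' Set.Ioi 0) :=
    (Set.Ioi_infinite 0).image Complex.ofReal_injective.injOn
  refine h.mono ?_
  rintro _ ⟨r, hr, rfl⟩
  exact ⟨by simpa using (ne_of_gt hr : r ≠ 0), r, rfl⟩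

/-- All members of the pencil spanned by `a` and `b` have the rank `R`. -/
def HasConstantRank (a b : LinearMap.BilinForm ℂ V) (R : ℕ) : Prop :=
  ∀ x y : ℂ, (x ≠ 0 ∨ y ≠ 0) → formRank (x • a + y • b) = R

variable {a b : LinearMap.BilinForm ℂ V} {R : ℕ}

/-- The freedom to discard a finite set `S` is what later separates the parameters of two kernels.
The pencil is recentred at the given member: by a translation of the parameter if `x ≠ 0`, and by t
↦ 1/t, with `a` and `b` exchanged, if `x = 0`. -/
lemma HasConstantRank.ker_le_iSup (h : HasConstantRank a b R) (x y : ℂ) (hxy : x ≠ 0 ∨ y ≠ 0)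
    (S : Set ℂ) (hS : S.Finite) :
    LinearMap.ker (x • a + y • b) ≤
      ⨆ t ∈ {t : ℂ | t ≠ 0 ∧ ∃ r : ℝ, (r : ℂ) = t} \ S, LinearMap.ker (a + t • b) := by
  set T := {t : ℂ | t ≠ 0 ∧ ∃ r : ℝ, (r : ℂ) = t} with hTdef
  by_cases hx : x = 0
  · have hy : y ≠ 0 := by tauto
    let S' : Set ℂ := (fun s => s⁻¹) ⁻¹' S
    have hS' : S'.Finite := hS.preimage inv_injective.injOn
    have h1 := ker_le_iSup_ker b a (infinite_pencilParameters S' hS') (by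
      intro t ht
      have e1 : formRank (b + t • a) = R := by simpa [add_comm] using h t 1 (by simp)
      have e2 : formRank b = R := by simpa using h 0 1 (by simp)
      exact (e1.trans e2.symm).le)
    have h2 : LinearMap.ker (x • a + y • b) = LinearMap.ker b := by
      rw [hx, zero_smul, zero_add, LinearMap.ker_smul _ _ hy]
    rw [h2]
    refine h1.trans (iSup₂_le fun t ht => ?_)
    have h3 : LinearMap.ker (b + t • a) = LinearMap.ker (a + t⁻¹ • b) := by
      rw [← LinearMap.ker_smul (a + t⁻¹ • b) t ht.1.1, smul_add, smul_smul, mul_inv_cancel₀ ht.1.1,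
        one_smul, add_comm]
    rw [h3]
    refine le_iSup₂_of_le t⁻¹ ⟨⟨inv_ne_zero ht.1.1, ?_⟩, ht.2⟩ le_rfl
    obtain ⟨r, hr⟩ := ht.1.2
    exact ⟨r⁻¹, by simp [hr]⟩
  · let S' : Set ℂ := (fun s => s + y / x) ⁻¹' S
    have hS' : S'.Finite := hS.preimage (add_left_injective _).injOn
    let T' : Set ℂ := (fun s => s + y / x) ⁻¹' (T \ S)
    have hT' : T'.Infinite := by
      refine (infinite_pencilParameters S hS).preimage fun t _ => ⟨t - y / x, by simp⟩
    have h1 := ker_le_iSup_ker (a + (y / x) • b) b hT' (by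
      intro t ht
      have e1 : formRank (a + (y / x) • b + t • b) = R := by
        rw [add_assoc, ← add_smul, add_comm (y / x)]
        simpa using h 1 (t + y / x) (by simp)
      have e2 : formRank (a + (y / x) • b) = R := by simpa using h 1 (y / x) (by simp)
      exact (e1.trans e2.symm).le)
    have h2 : LinearMap.ker (x • a + y • b) = LinearMap.ker (a + (y / x) • b) := by
      rw [← LinearMap.ker_smul (a + (y / x) • b) x hx, smul_add, smul_smul, mul_div_cancel₀ _ hx]
    rw [h2]
    refine h1.trans (iSup₂_le fun t ht => ?_)
    rw [add_assoc, ← add_smul, add_comm (y / x)]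
    exact le_iSup₂_of_le (t + y / x) ht le_rfl

lemma HasConstantRank.ker_le_pencilCore (h : HasConstantRank a b R) (x y : ℂ)
    (hxy : x ≠ 0 ∨ y ≠ 0) : LinearMap.ker (x • a + y • b) ≤ pencilCore a b := by
  have := h.ker_le_iSup x y hxy ∅ Set.finite_empty
  rwa [Set.sdiff_empty] at this

/-- On the kernel of a + tb one has bv = -a(v/t), so every member sends the core into its image
under `a`. The core contains the kernel of each nonzero member and these kernels have equal
dimension, so the images have equal dimension as well. -/
lemma HasConstantRank.map_pencilCore (h : HasConstantRank a b R) (x y : ℂ)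
    (hxy : x ≠ 0 ∨ y ≠ 0) :
    (pencilCore a b).map (x • a + y • b) = (pencilCore a b).map a := by
  have hba : (pencilCore a b).map b ≤ (pencilCore a b).map a := by
    rw [pencilCore, Submodule.map_iSup]
    refine iSup_le fun t => ?_
    rw [Submodule.map_iSup]
    refine iSup_le fun ht => ?_
    rintro _ ⟨v, hv, rfl⟩
    refine ⟨-(t⁻¹ • v), Submodule.neg_mem _ (Submodule.smul_mem _ _
      ((le_iSup₂_of_le (f := fun t (_ : t ∈ {t : ℂ | t ≠ 0 ∧ ∃ r : ℝ, (r : ℂ) = t}) =>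
        LinearMap.ker (a + t • b)) t ht le_rfl) hv)), ?_⟩
    have h1 : a v = -(t • b v) := eq_neg_of_add_eq_zero_left hv
    rw [map_neg, map_smul, h1, smul_neg, neg_neg, smul_smul, inv_mul_cancel₀ ht.1, one_smul]
  have hle : (pencilCore a b).map (x • a + y • b) ≤ (pencilCore a b).map a := by
    rintro _ ⟨v, hv, rfl⟩
    exact Submodule.add_mem _ (Submodule.smul_mem _ _ (Submodule.mem_map_of_mem hv))
      (Submodule.smul_mem _ _ (hba (Submodule.mem_map_of_mem hv)))
  have hdim (m : LinearMap.BilinForm ℂ V) (hm : formRank m = R)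
      (hk : LinearMap.ker m ≤ pencilCore a b) :
      finrank ℂ ((pencilCore a b).map m) + (finrank ℂ V - R) = finrank ℂ (pencilCore a b) := by
    have h1 := LinearMap.finrank_range_add_finrank_ker m
    have h2 := LinearMap.finrank_range_add_finrank_ker (m.domRestrict (pencilCore a b))
    have h3 : LinearMap.range (m.domRestrict (pencilCore a b)) = (pencilCore a b).map m :=
      LinearMap.range_domRestrict _ _
    have h4 : finrank ℂ (LinearMap.ker (m.domRestrict (pencilCore a b))) =
        finrank ℂ (LinearMap.ker m) := by
      rw [LinearMap.ker_domRestrict]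
      exact (Submodule.comapSubtypeEquivOfLe hk).finrank_eq
    rw [h3, h4] at h2
    change finrank ℂ (LinearMap.range m) = R at hm
    omega
  refine Submodule.eq_of_le_of_finrank_eq hle ?_
  have e1 := hdim _ (h x y hxy) (h.ker_le_pencilCore x y hxy)
  have e2 := hdim a (by simpa using h 1 0 (by simp))
    (by simpa using h.ker_le_pencilCore 1 0 (by simp))
  omega

/-- Vectors from the kernels of two different members a + tb and a + sb are orthogonal for both `a`
and `b`. Equal parameters are avoided by covering the second kernel with kernels of parameters other
than t. -/
lemma HasConstantRank.isotropic (h : HasConstantRank a b R) (ha : a.IsAlt) (hb : b.IsAlt)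
    {u v : V} (hu : u ∈ pencilCore a b) (hv : v ∈ pencilCore a b) : a u v = 0 := by
  have key (t s : ℂ) (hts : t ≠ s) (u v : V) (hu : u ∈ LinearMap.ker (a + t • b))
      (hv : v ∈ LinearMap.ker (a + s • b)) : a u v = 0 := by
    have h1 : a u v + t * b u v = 0 := LinearMap.congr_fun hu v
    have h2 : a v u + s * b v u = 0 := LinearMap.congr_fun hv u
    rw [← ha.neg_eq, ← hb.neg_eq] at h2
    have h3 : (t - s) * b u v = 0 := by linear_combination h1 + h2
    have h4 : b u v = 0 := (mul_eq_zero.1 h3).resolve_left (sub_ne_zero.2 hts)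
    simpa [h4] using h1
  have step (u : V) (t : ℂ) (hu : u ∈ LinearMap.ker (a + t • b)) (v : V)
      (hv : v ∈ pencilCore a b) : a u v = 0 := by
    have hle : pencilCore a b ≤ LinearMap.ker (a u) := by
      refine iSup₂_le fun s hs => ?_
      have h1 := h.ker_le_iSup 1 s (by simp) {t} (Set.finite_singleton t)
      rw [one_smul] at h1
      refine h1.trans (iSup₂_le fun r hr => ?_)
      intro w hw
      exact key t r (fun h => hr.2 h.symm) u w hu hw
    exact hle hv
  have hle : pencilCore a b ≤ LinearMap.ker (a.flip v) :=
    iSup₂_le fun s _ u hu => step u s hu v hv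
  exact hle hu

/-- The core of a pencil of constant rank is its own skew-orthogonal complement with respect to
every nonzero member. -/
theorem HasConstantRank.mem_pencilCore_iff (h : HasConstantRank a b R) (ha : a.IsAlt)
    (hb : b.IsAlt) (x y : ℂ) (hxy : x ≠ 0 ∨ y ≠ 0) (v : V) :
    v ∈ pencilCore a b ↔ ∀ u ∈ pencilCore a b, (x • a + y • b) u v = 0 := by
  set Φ := pencilCore a b with hΦ
  -- All nonzero members send Φ onto the same space, so `Q` is the complement of Φ for each of them
  -- at once.
  set Q : Submodule ℂ V := (Φ.map a).dualCoannihilator with hQ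
  have hQm (x y : ℂ) (hxy : x ≠ 0 ∨ y ≠ 0) (v : V) :
      v ∈ Q ↔ ∀ u ∈ Φ, (x • a + y • b) u v = 0 := by
    rw [hQ, ← h.map_pencilCore x y hxy, Submodule.mem_dualCoannihilator]
    exact ⟨fun h u hu => h _ ⟨u, hu, rfl⟩, by rintro h _ ⟨u, hu, rfl⟩; exact h u hu⟩
  have hΦQ : Φ ≤ Q := by
    intro v hv
    rw [hQm 1 0 (by simp)]
    intro u hu
    simpa using h.isotropic ha hb hu hv
  rw [← hQm x y hxy]
  refine ⟨fun hv => hΦQ hv, ?_⟩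
  suffices hQΦ : Q ≤ Φ from fun hv => hQΦ hv
  have hskew (x y : ℂ) (u v : V) : (x • a + y • b) u v = -((x • a + y • b) v u) := by
    simp only [LinearMap.add_apply, LinearMap.smul_apply]
    rw [← ha.neg_eq, ← hb.neg_eq]
    simp only [smul_eq_mul]
    ring
  -- The radical of a member m on `Q` lies in Φ: if mq kills `Q`, then mq ∈ m(Φ) by double
  -- annihilators, so q lies in Φ + ker m = Φ.
  have hdeg (x y : ℂ) (hxy : x ≠ 0 ∨ y ≠ 0) (q : V) (hq : q ∈ Q)
      (h0 : ∀ w ∈ Q, (x • a + y • b) q w = 0) : q ∈ Φ := by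
    have h1 : (x • a + y • b) q ∈ Q.dualAnnihilator := (Submodule.mem_dualAnnihilator _).2 h0
    rw [hQ, Subspace.dualCoannihilator_dualAnnihilator_eq, ← h.map_pencilCore x y hxy] at h1
    obtain ⟨u, hu, hqu⟩ := h1
    have h2 : q - u ∈ LinearMap.ker (x • a + y • b) := by
      rw [LinearMap.mem_ker, map_sub, hqu, sub_self]
    have h3 := Submodule.add_mem _ (h.ker_le_pencilCore x y hxy h2) hu
    rwa [sub_add_cancel] at h3
  obtain ⟨C', hC'⟩ := Submodule.exists_isCompl Φ
  let C : Submodule ℂ V := C' ⊓ Q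
  have hC : ∀ q ∈ Q, ∃ u ∈ Φ, ∃ w ∈ C, u + w = q := by
    intro q hq
    obtain ⟨u, hu, w, hw, rfl⟩ := Submodule.mem_sup.1
      (show q ∈ Φ ⊔ C' by rw [hC'.sup_eq_top]; trivial)
    refine ⟨u, hu, w, ⟨hw, ?_⟩, rfl⟩
    have := Submodule.sub_mem _ hq (hΦQ hu)
    rwa [add_sub_cancel_left] at this
  have hCΦ : ∀ w ∈ C, w ∈ Φ → w = 0 := fun w hw hw' =>
    (Submodule.disjoint_def.1 hC'.disjoint) w hw' hw.1
  have hdegC (x y : ℂ) (hxy : x ≠ 0 ∨ y ≠ 0) (q : V) (hq : q ∈ C)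
      (h0 : ∀ w ∈ C, (x • a + y • b) q w = 0) : q = 0 := by
    refine hCΦ q hq (hdeg x y hxy q hq.2 fun w hw => ?_)
    obtain ⟨u, hu, w', hw', rfl⟩ := hC w hw
    rw [map_add, h0 w' hw', hskew, (hQm x y hxy q).1 hq.2 u hu, neg_zero, zero_add]
  -- Every nonzero member is nondegenerate on `C`. If `C` were nonzero, b⁻¹a would have a complex
  -- eigenvalue μ there, and a - μb would be degenerate.
  have hCbot : C = ⊥ := by
    by_contra hne
    have : Nontrivial C := Submodule.nontrivial_iff_ne_bot.2 hne
    let aC : C →ₗ[ℂ] Dual ℂ C := a.domRestrict₁₂ C C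
    let bC : C →ₗ[ℂ] Dual ℂ C := b.domRestrict₁₂ C C
    have hbinj : Function.Injective bC := by
      rw [← LinearMap.ker_eq_bot, LinearMap.ker_eq_bot']
      intro q hq
      refine Subtype.ext (hdegC 0 1 (by simp) q q.2 fun w hw => ?_)
      have := LinearMap.congr_fun hq ⟨w, hw⟩
      simpa using! this
    let be : C ≃ₗ[ℂ] Dual ℂ C := LinearEquiv.ofInjectiveOfFinrankEq bC hbinj
      (Subspace.dual_finrank_eq).symm
    obtain ⟨μ, hμ⟩ := Module.End.exists_eigenvalue (be.symm.toLinearMap ∘ₗ aC)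
    obtain ⟨q, hq, hq0⟩ := hμ.exists_hasEigenvector
    apply hq0
    refine Subtype.ext (hdegC 1 (-μ) (by simp) q q.2 fun w hw => ?_)
    have h1 : be.symm (aC q) = μ • q := Module.End.mem_eigenspace_iff.1 hq
    have h2 : aC q = μ • bC q := by
      rw [LinearEquiv.symm_apply_eq, map_smul] at h1
      exact h1
    have h3 : a q w = μ * b q w := LinearMap.congr_fun h2 ⟨w, hw⟩
    simp [h3]
  intro q hq
  obtain ⟨u, hu, w, hw, rfl⟩ := hC q hq
  rw [hCbot, Submodule.mem_bot] at hw
  rwa [hw, add_zero]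

end AlternatingPencil

/-! ### Complexification of real bilinear forms -/

section Complexification

open Module TensorProduct

variable {W : Type*} [AddCommGroup W] [Module ℝ W]

lemma exists_eq_one_tmul_add (u : ℂ ⊗[ℝ] W) :
    ∃ α β : W, u = (1 : ℂ) ⊗ₜ[ℝ] α + Complex.I • ((1 : ℂ) ⊗ₜ[ℝ] β) := by
  induction u with
  | zero => exact ⟨0, 0, by simp⟩
  | tmul z α =>
    refine ⟨z.re • α, z.im • α, ?_⟩
    conv_lhs => rw [← Complex.re_add_im z]
    rw [TensorProduct.smul_tmul', ← TensorProduct.smul_tmul, ← TensorProduct.smul_tmul,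
      ← TensorProduct.add_tmul]
    congr 1
    simp [mul_comm]
  | add u v hu hv =>
    obtain ⟨α, β, rfl⟩ := hu
    obtain ⟨α', β', rfl⟩ := hv
    refine ⟨α + α', β + β', ?_⟩
    rw [tmul_add, tmul_add, smul_add]
    abel

lemma bilinForm_ext_complexification {B B' : LinearMap.BilinForm ℂ (ℂ ⊗[ℝ] W)}
    (h : ∀ α β : W, B (1 ⊗ₜ α) (1 ⊗ₜ β) = B' (1 ⊗ₜ α) (1 ⊗ₜ β)) : B = B' := by
  refine LinearMap.ext fun u => LinearMap.ext fun v => ?_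
  obtain ⟨α, β, rfl⟩ := exists_eq_one_tmul_add u
  obtain ⟨α', β', rfl⟩ := exists_eq_one_tmul_add v
  simp only [map_add, map_smul, LinearMap.add_apply, LinearMap.smul_apply, h]

lemma baseChange_one_tmul (B : LinearMap.BilinForm ℝ W) (α β : W) :
    B.baseChange ℂ (1 ⊗ₜ α) (1 ⊗ₜ β) = (B α β : ℂ) := by
  simp

lemma one_tmul_mem_ker_iff (B : LinearMap.BilinForm ℂ (ℂ ⊗[ℝ] W)) (α : W) :
    (1 : ℂ) ⊗ₜ[ℝ] α ∈ LinearMap.ker B ↔ ∀ β : W, B (1 ⊗ₜ α) (1 ⊗ₜ β) = 0 := by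
  refine ⟨fun h β => LinearMap.congr_fun h _, fun h => LinearMap.ext fun v => ?_⟩
  obtain ⟨α', β', rfl⟩ := exists_eq_one_tmul_add v
  rw [map_add, map_smul, h, h]
  simp

lemma ker_baseChange_complex (B : LinearMap.BilinForm ℝ W) :
    LinearMap.ker (B.baseChange ℂ) = (LinearMap.ker B).baseChange ℂ := by
  apply le_antisymm
  · intro u hu
    obtain ⟨α, β, rfl⟩ := exists_eq_one_tmul_add u
    have h (γ : W) : (B α γ : ℂ) + Complex.I * B β γ = 0 := by
      have := LinearMap.congr_fun hu (1 ⊗ₜ γ)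
      rw [map_add, map_smul, LinearMap.add_apply, LinearMap.smul_apply, baseChange_one_tmul,
        baseChange_one_tmul] at this
      exact this
    have hα : α ∈ LinearMap.ker B := LinearMap.ext fun γ => by
      simpa using congrArg Complex.re (h γ)
    have hβ : β ∈ LinearMap.ker B := LinearMap.ext fun γ => by
      simpa using congrArg Complex.im (h γ)
    exact Submodule.add_mem _ (Submodule.tmul_mem_baseChange_of_mem 1 hα)
      (Submodule.smul_mem _ _ (Submodule.tmul_mem_baseChange_of_mem 1 hβ))
  · rw [Submodule.baseChange_eq_span, Submodule.span_le]
    rintro _ ⟨α, hα, rfl⟩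
    refine (one_tmul_mem_ker_iff _ α).2 fun β => ?_
    rw [baseChange_one_tmul, LinearMap.mem_ker.1 hα]
    simp

lemma finrank_submodule_baseChange (p : Submodule ℝ W) :
    finrank ℂ (p.baseChange ℂ) = finrank ℝ p := by
  have hinj : Function.Injective (p.subtype.baseChange ℂ) :=
    Module.Flat.lTensor_preserves_injective_linearMap (M := ℂ) p.subtype p.injective_subtype
  change finrank ℂ (LinearMap.range (p.subtype.baseChange ℂ)) = _
  rw [LinearMap.finrank_range_of_inj hinj, Module.finrank_baseChange]

lemma formRank_baseChange [FiniteDimensional ℝ W] (B : LinearMap.BilinForm ℝ W) :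
    formRank (B.baseChange ℂ) = formRank B := by
  have h1 := LinearMap.finrank_range_add_finrank_ker B
  have h2 := LinearMap.finrank_range_add_finrank_ker (B.baseChange ℂ)
  rw [ker_baseChange_complex, finrank_submodule_baseChange, Module.finrank_baseChange] at h2
  change finrank ℂ (LinearMap.range (B.baseChange ℂ)) = finrank ℝ (LinearMap.range B)
  omega

lemma isAlt_baseChange {B : LinearMap.BilinForm ℝ W} (hB : B.IsAlt) : (B.baseChange ℂ).IsAlt := by
  intro u
  obtain ⟨α, β, rfl⟩ := exists_eq_one_tmul_add u
  simp only [map_add, map_smul, LinearMap.add_apply, LinearMap.smul_apply, baseChange_one_tmul,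
    hB.self_eq_zero]
  rw [← hB.neg_eq α β]
  simp

lemma baseChange_combination (x y x' y' : ℝ) (A B : LinearMap.BilinForm ℝ W) :
    (x • A + y • B).baseChange ℂ + Complex.I • (x' • A + y' • B).baseChange ℂ =
      (⟨x, x'⟩ : ℂ) • A.baseChange ℂ + (⟨y, y'⟩ : ℂ) • B.baseChange ℂ := by
  refine bilinForm_ext_complexification fun α β => ?_
  simp only [LinearMap.add_apply, LinearMap.smul_apply, baseChange_one_tmul, smul_eq_mul]
  apply Complex.ext <;> simp

lemma baseChange_add_smul (r : ℝ) (A B : LinearMap.BilinForm ℝ W) :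
    (A + r • B).baseChange ℂ = A.baseChange ℂ + (r : ℂ) • B.baseChange ℂ := by
  refine bilinForm_ext_complexification fun α β => ?_
  simp only [LinearMap.add_apply, LinearMap.smul_apply, baseChange_one_tmul, smul_eq_mul]
  simp

end Complexification

/-! ### Lower semicontinuity of the rank -/

section Semicontinuity

open Module

/-- The rank of a continuous family of bilinear forms is lower semicontinuous. -/
lemma isOpen_le_formRank {Z U : Type*} [TopologicalSpace Z] [AddCommGroup U] [Module ℂ U]
    [FiniteDimensional ℂ U] {S : Set Z} (hS : IsOpen S) (B : Z → LinearMap.BilinForm ℂ U)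
    (hB : ∀ u v, ContinuousOn (fun z => B z u v) S) (k : ℕ) :
    IsOpen (S ∩ {z | k ≤ formRank (B z)}) := by
  let b := Module.finBasis ℂ U
  let L : Z → (Fin (finrank ℂ U) → ℂ) →L[ℂ] (Fin (finrank ℂ U) → ℂ) := fun z =>
    LinearMap.toContinuousLinearMap
      (b.dualBasis.equivFun.toLinearMap ∘ₗ B z ∘ₗ b.equivFun.symm.toLinearMap)
  have hL : ContinuousOn L S := by
    refine continuousOn_clm_apply.2 fun v => continuousOn_pi.2 fun i => ?_
    refine (hB (b.equivFun.symm v) (b i)).congr fun z _ => ?_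
    exact b.dualBasis_equivFun _ i
  have hrank (z : Z) : (L z).toLinearMap.rank = formRank (B z) := by
    have h : finrank ℂ (LinearMap.range (L z).toLinearMap) = formRank (B z) := by
      have h1 : (L z).toLinearMap =
        b.dualBasis.equivFun.toLinearMap ∘ₗ B z ∘ₗ b.equivFun.symm.toLinearMap := rfl
      rw [h1, LinearMap.range_comp, LinearMap.range_comp_of_range_eq_top _ (LinearEquiv.range _)]
      exact LinearEquiv.finrank_map_eq b.dualBasis.equivFun _
    rw [LinearMap.rank, ← h, Module.finrank_eq_rank]
  have := hL.isOpen_inter_preimage hS (isOpen_setOfPred_nat_le_rank (𝕜 := ℂ)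
    (E := Fin (finrank ℂ U) → ℂ) (F := Fin (finrank ℂ U) → ℂ) k)
  convert! this using 2
  ext z
  simp only [Set.mem_ofPred_eq, Set.mem_preimage]
  change _ ↔ (k : Cardinal) ≤ (L z).toLinearMap.rank
  rw [hrank, Nat.cast_le]

end Semicontinuity

/-! ### Linear algebra in the tangent spaces of a holomorphic symplectic manifold -/

section SymplecticLinear

open Module

variable {E U : Type*} [AddCommGroup E] [Module ℂ E] [FiniteDimensional ℂ E]
  [AddCommGroup U] [Module ℂ U]

/-- In a symplectic space, let `Φ` be equal to its skew-orthogonal complement with respect to the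
form induced by `f` on the domain of `f`, the image of which is coisotropic. Then the image of `Φ`
is lagrangian. -/
lemma orthogonal_map_eq {B : LinearMap.BilinForm ℂ E} (hB : B.Nondegenerate) (halt : B.IsAlt)
    (f : U →ₗ[ℂ] E) (hf : B.orthogonal (LinearMap.range f) ≤ LinearMap.range f)
    (Φ : Submodule ℂ U) (hΦ : ∀ u, u ∈ Φ ↔ ∀ w ∈ Φ, B (f w) (f u) = 0) :
    B.orthogonal (Φ.map f) = Φ.map f := by
  -- A vector f(u) orthogonal to the whole image is in particular orthogonal to f(Φ), which forces u
  -- ∈ Φ. Taking complements then confines f(Φ)^⊥ to the image of `f`.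
  have hle : B.orthogonal (LinearMap.range f) ≤ Φ.map f := by
    intro w hw
    obtain ⟨u, rfl⟩ := hf hw
    exact ⟨u, (hΦ u).2 fun k _ => hw _ ⟨k, rfl⟩, rfl⟩
  apply le_antisymm
  · intro v hv
    have h1 : v ∈ B.orthogonal (B.orthogonal (LinearMap.range f)) :=
      LinearMap.BilinForm.orthogonal_le hle hv
    rw [LinearMap.BilinForm.orthogonal_orthogonal hB halt.isRefl] at h1
    obtain ⟨u, rfl⟩ := h1
    exact ⟨u, (hΦ u).2 fun w hw => hv _ ⟨w, hw, rfl⟩, rfl⟩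
  · rintro _ ⟨u, hu, rfl⟩ _ ⟨w, hw, rfl⟩
    exact (hΦ u).1 hu w hw

/-- A subspace is coisotropic if and only if the restriction of the form to it has small rank. -/
lemma orthogonal_le_iff {B : LinearMap.BilinForm ℂ E} (hB : B.Nondegenerate) (halt : B.IsAlt)
    (R : Submodule ℂ E) :
    B.orthogonal R ≤ R ↔
      formRank (B.domRestrict₁₂ R R : LinearMap.BilinForm ℂ R) + finrank ℂ E ≤
        2 * finrank ℂ R := by
  have h2 := LinearMap.finrank_range_add_finrank_ker
    (B.domRestrict₁₂ R R : LinearMap.BilinForm ℂ R)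
  have h4 : LinearMap.ker (B.domRestrict₁₂ R R : LinearMap.BilinForm ℂ R) =
      (B.orthogonal R).comap R.subtype := by
    ext v
    rw [LinearMap.mem_ker, Submodule.mem_comap, LinearMap.BilinForm.mem_orthogonal_iff]
    constructor
    · intro hv w hw
      have h5 : B v w = 0 := LinearMap.congr_fun hv ⟨w, hw⟩
      exact halt.isRefl _ _ h5
    · intro hv
      exact LinearMap.ext fun w => halt.isRefl _ _ (hv w w.2)
  have h3 : finrank ℂ (LinearMap.ker (B.domRestrict₁₂ R R : LinearMap.BilinForm ℂ R)) =
      finrank ℂ (R ⊓ B.orthogonal R : Submodule ℂ E) := by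
    rw [h4, ← Submodule.map_comap_subtype]
    exact (Submodule.equivSubtypeMap R _).finrank_eq
  -- The radical R ∩ R^⊥ has dimension dim R - rank and R^⊥ has dimension dim E - dim R; the rank
  -- bound says that the radical fills R^⊥.
  have h7 := LinearMap.BilinForm.finrank_orthogonal hB R
  have h8 : finrank ℂ R ≤ finrank ℂ E := Submodule.finrank_le R
  rw [h3] at h2
  rw [formRank]
  constructor
  · intro h
    rw [inf_eq_right.2 h] at h2
    omega
  · intro h
    have h9 : R ⊓ B.orthogonal R = B.orthogonal R :=
      Submodule.eq_of_le_of_finrank_le inf_le_right (by omega)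
    exact inf_eq_right.1 h9

/-- The image of `f` is coisotropic if and only if the form induced by `f` has small rank. -/
lemma orthogonal_range_le_iff {B : LinearMap.BilinForm ℂ E} (hB : B.Nondegenerate)
    (halt : B.IsAlt) (f : U →ₗ[ℂ] E) :
    B.orthogonal (LinearMap.range f) ≤ LinearMap.range f ↔
      formRank (B.compl₁₂ f f : LinearMap.BilinForm ℂ U) + finrank ℂ E ≤
        2 * finrank ℂ (LinearMap.range f) := by
  have h : (B.compl₁₂ f f : LinearMap.BilinForm ℂ U) =
      (B.domRestrict₁₂ (LinearMap.range f) (LinearMap.range f)).compl₁₂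
        f.rangeRestrict f.rangeRestrict :=
    LinearMap.ext₂ fun u v => rfl
  rw [orthogonal_le_iff hB halt, h, formRank_compl₁₂ _ f.surjective_rangeRestrict]

end SymplecticLinear

/-! ### CR-subspaces as skew-orthogonal complements of Hamiltonian vectors -/

section CRLinear

open Module TensorProduct

variable {E : Type*} [NormedAddCommGroup E] [NormedSpace ℂ E]

lemma isAlt_toBilin (η : E [⋀^Fin 2]→L[ℂ] ℂ) : (toBilin η).IsAlt := fun v =>
  η.map_eq_zero_of_eq ![v, v] (i := 0) (j := 1) rfl (by simp)

lemma covectorOneZero_apply (α : Dual ℝ E) (v : E) :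
    covectorOneZero α v = (1 / 2 : ℂ) * ((α v : ℂ) - Complex.I * α (Complex.I • v)) := by
  rw [covectorOneZero, LinearMap.smul_apply, Module.Dual.extendRCLikeₗ_apply,
    Module.Dual.extendRCLike_apply]
  rfl

lemma covectorOneZero_eq_zero_iff (α : Dual ℝ E) (v : E) :
    covectorOneZero α v = 0 ↔ α v = 0 ∧ α (Complex.I • v) = 0 := by
  rw [covectorOneZero_apply, mul_eq_zero, or_iff_right (by norm_num), Complex.ext_iff]
  simp

lemma mem_crSubspace_iff (D : Submodule ℝ E) (v : E) :
    v ∈ crSubspace D ↔ v ∈ D ∧ Complex.I • v ∈ D := by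
  constructor
  · rintro ⟨h1, w, hw, rfl⟩
    refine ⟨h1, ?_⟩
    have : Complex.I • complexStructure E w = -w := by
      simp [complexStructure, smul_smul]
    rw [this]
    exact D.neg_mem hw
  · rintro ⟨h1, h2⟩
    refine ⟨h1, -(Complex.I • v), D.neg_mem h2, ?_⟩
    simp [complexStructure, smul_smul]

variable [FiniteDimensional ℂ E] {M : Type*} [TopologicalSpace M] [ChartedSpace E M]
  {E' : Type*} [NormedAddCommGroup E'] [NormedSpace ℝ E']
  {M' : Type*} [TopologicalSpace M'] [ChartedSpace E' M']

lemma toBilin_sharp (Ω : HolomorphicSymplecticForm E M) (x : M) (ξ : Dual ℂ E) (v : E) :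
    toBilin (Ω.toFun x) (sharp Ω x ξ) v = ξ v :=
  LinearMap.BilinForm.apply_toDual_symm_apply (hB := Ω.nondegenerate x) ξ v

/-- The Hamiltonian vector of the `(1,0)`-part of the pull-back of a covector on `M'`. -/
def hamiltonianLift (Ω : HolomorphicSymplecticForm E M) (p : M → M') (x : M) :
    Dual ℝ E' →ₗ[ℝ] E where
  toFun α := sharp Ω x (covectorOneZero (α ∘ₗ realDifferential E E' p x))
  map_add' α β := by
    rw [LinearMap.add_comp, covectorOneZero_add, map_add]
  map_smul' r α := by
    rw [LinearMap.smul_comp, covectorOneZero_smul, map_smul]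
    exact Complex.coe_smul r _

/-- The complex linear extension of `hamiltonianLift`. -/
def complexLift (Ω : HolomorphicSymplecticForm E M) (p : M → M') (x : M) :
    ℂ ⊗[ℝ] Dual ℝ E' →ₗ[ℂ] E :=
  (hamiltonianLift Ω p x).liftBaseChange ℂ

lemma complexLift_one_tmul (Ω : HolomorphicSymplecticForm E M) (p : M → M') (x : M)
    (α : Dual ℝ E') :
    complexLift Ω p x (1 ⊗ₜ α) =
      sharp Ω x (covectorOneZero (α ∘ₗ realDifferential E E' p x)) := by
  rw [complexLift, LinearMap.liftBaseChange_tmul, one_smul]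
  rfl

lemma toBilin_complexLift_eq_complexValue (Ω : HolomorphicSymplecticForm E M) (p : M → M') (x : M)
    {c₁ c₂ : TensorField E' M'} (h₁ : IsPushforward p (reBivector Ω) c₁)
    (h₂ : IsPushforward p (imBivector Ω) c₂) :
    (toBilin (Ω.toFun x)).compl₁₂ (complexLift Ω p x) (complexLift Ω p x) =
      complexValue c₁ c₂ (p x) := by
  refine bilinForm_ext_complexification fun α β => ?_
  rw [LinearMap.compl₁₂_apply, complexLift_one_tmul, complexLift_one_tmul, complexValue,
    LinearMap.add_apply, LinearMap.smul_apply, LinearMap.add_apply, LinearMap.smul_apply,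
    baseChange_one_tmul, baseChange_one_tmul, h₁, h₂]
  change inverseBivector Ω x _ _ = ((inverseBivector Ω x _ _).re : ℂ) +
    Complex.I * ((inverseBivector Ω x _ _).im : ℂ)
  rw [mul_comm]
  exact (Complex.re_add_im _).symm

/-- The `CR`-subspace of a pulled back subspace is a skew-orthogonal complement. -/
lemma crSubspace_comap (Ω : HolomorphicSymplecticForm E M) (p : M → M') (x : M)
    (D' : Submodule ℝ E') :
    crSubspace (D'.comap (realDifferential E E' p x)) = (toBilin (Ω.toFun x)).orthogonal
      ((D'.dualAnnihilator.baseChange ℂ).map (complexLift Ω p x)) := by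
  ext v
  have hD (w : E) : w ∈ D'.comap (realDifferential E E' p x) ↔
      ∀ α ∈ D'.dualAnnihilator, (α ∘ₗ realDifferential E E' p x) w = 0 :=
    (Subspace.forall_mem_dualAnnihilator_apply_eq_zero_iff D' _).symm
  have hα (α : Dual ℝ E') : toBilin (Ω.toFun x) (complexLift Ω p x (1 ⊗ₜ α)) v = 0 ↔
      (α ∘ₗ realDifferential E E' p x) v = 0 ∧
      (α ∘ₗ realDifferential E E' p x) (Complex.I • v) = 0 := by
    rw [complexLift_one_tmul, toBilin_sharp, covectorOneZero_eq_zero_iff]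
  rw [mem_crSubspace_iff, hD, hD]
  constructor
  · rintro ⟨h1, h2⟩
    rw [Submodule.baseChange_eq_span, Submodule.map_span]
    intro w hw
    refine (Submodule.span_le (p := LinearMap.ker ((toBilin (Ω.toFun x)).flip v))).2 ?_ hw
    rintro _ ⟨_, ⟨α, hα', rfl⟩, rfl⟩
    exact (hα α).2 ⟨h1 α hα', h2 α hα'⟩
  · intro h
    have h' (α) (hα' : α ∈ D'.dualAnnihilator) := (hα α).1
      (h _ ⟨_, Submodule.tmul_mem_baseChange_of_mem 1 hα', rfl⟩)
    exact ⟨fun α hα' => (h' α hα').1, fun α hα' => (h' α hα').2⟩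

lemma crSubspace_fibreTangent (Ω : HolomorphicSymplecticForm E M) (p : M → M') (x : M) :
    crSubspace (fibreTangent E E' p x) =
      (toBilin (Ω.toFun x)).orthogonal (LinearMap.range (complexLift (E' := E') Ω p x)) := by
  have h := crSubspace_comap Ω p x (⊥ : Submodule ℝ E')
  rw [Submodule.dualAnnihilator_bot, Submodule.baseChange_top, Submodule.map_top] at h
  exact h

lemma crSubspace_fibreTangent_isotropic_iff (Ω : HolomorphicSymplecticForm E M) (p : M → M')
    (x : M) :
    crSubspace (fibreTangent E E' p x) ≤
      (toBilin (Ω.toFun x)).orthogonal (crSubspace (fibreTangent E E' p x)) ↔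
    (toBilin (Ω.toFun x)).orthogonal (LinearMap.range (complexLift (E' := E') Ω p x)) ≤
      LinearMap.range (complexLift (E' := E') Ω p x) := by
  rw [crSubspace_fibreTangent Ω, LinearMap.BilinForm.orthogonal_orthogonal (Ω.nondegenerate x)
    (isAlt_toBilin _).isRefl]

/-- If α + iβ is sent to 0, the pull-backs satisfy α'(v) = -β'(iv). Both vanish on T𝒦, so β'
vanishes also on 𝒥T𝒦, hence everywhere by genericity; surjectivity of dp then gives α = β = 0. -/
lemma complexLift_injective (Ω : HolomorphicSymplecticForm E M) (p : M → M') (x : M)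
    (hp : Function.Surjective (realDifferential E E' p x))
    (hgen : fibreTangent E E' p x ⊔ (fibreTangent E E' p x).map (complexStructure E) = ⊤) :
    Function.Injective (complexLift (E' := E') Ω p x) := by
  rw [← LinearMap.ker_eq_bot, LinearMap.ker_eq_bot']
  intro u hu
  obtain ⟨α, β, rfl⟩ := exists_eq_one_tmul_add u
  rw [map_add, map_smul, complexLift_one_tmul, complexLift_one_tmul, ← map_smul, ← map_add,
    LinearEquiv.map_eq_zero_iff] at hu
  set α' := α ∘ₗ realDifferential E E' p x with hα'
  set β' := β ∘ₗ realDifferential E E' p x with hβ'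
  have h (v : E) : α' v = - β' (Complex.I • v) := by
    have h1 := congrArg Complex.re (LinearMap.congr_fun hu v)
    rw [LinearMap.add_apply, LinearMap.smul_apply, covectorOneZero_apply,
      covectorOneZero_apply] at h1
    simp at h1
    linarith
  have hker (v : E) (hv : v ∈ fibreTangent E E' p x) (γ : Dual ℝ E') :
      (γ ∘ₗ realDifferential E E' p x) v = 0 := by
    rw [LinearMap.comp_apply, LinearMap.mem_ker.1 hv, map_zero]
  have hβ0 : β' = 0 := by
    have hle : (⊤ : Submodule ℝ E) ≤ LinearMap.ker β' := by
      rw [← hgen, sup_le_iff]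
      refine ⟨fun v hv => hker v hv β, ?_⟩
      rintro _ ⟨v, hv, rfl⟩
      have h1 := h v
      rw [hker v hv α, zero_eq_neg] at h1
      exact h1
    exact LinearMap.ext fun v => hle (Submodule.mem_top (x := v))
  have hα0 : α' = 0 := LinearMap.ext fun v => by rw [h, hβ0]; simp
  have hcancel (γ : Dual ℝ E') (hγ : γ ∘ₗ realDifferential E E' p x = 0) : γ = 0 := by
    refine LinearMap.ext fun v => ?_
    obtain ⟨w, rfl⟩ := hp v
    exact LinearMap.congr_fun hγ w
  rw [hcancel α hα0, hcancel β hβ0]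
  simp

/-- For a generic `CR`-foliation, `CR`-isotropy at a point is a bound for the rank of the
projected complex bivector. -/
lemma crSubspace_fibreTangent_isotropic_iff_rank [FiniteDimensional ℝ E']
    (Ω : HolomorphicSymplecticForm E M) (p : M → M') (x : M)
    (hp : Function.Surjective (realDifferential E E' p x))
    (hgen : fibreTangent E E' p x ⊔ (fibreTangent E E' p x).map (complexStructure E) = ⊤)
    {c₁ c₂ : TensorField E' M'} (h₁ : IsPushforward p (reBivector Ω) c₁)
    (h₂ : IsPushforward p (imBivector Ω) c₂) :
    crSubspace (fibreTangent E E' p x) ≤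
      (toBilin (Ω.toFun x)).orthogonal (crSubspace (fibreTangent E E' p x)) ↔
    formRank (complexValue c₁ c₂ (p x)) + finrank ℂ E ≤ 2 * finrank ℝ E' := by
  rw [crSubspace_fibreTangent_isotropic_iff, orthogonal_range_le_iff (Ω.nondegenerate x)
    (isAlt_toBilin _),
    toBilin_complexLift_eq_complexValue Ω p x h₁ h₂,
    LinearMap.finrank_range_of_inj (complexLift_injective Ω p x hp hgen),
    Module.finrank_baseChange, Subspace.dual_finrank_eq]

end CRLinear

/-! ### Complete bihamiltonian structures -/

section CompleteStructures

open Module Filter Topology TensorProduct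

universe u

variable {F : Type u} [NormedAddCommGroup F] [NormedSpace ℝ F] [FiniteDimensional ℝ F]
  {N : Type*} [TopologicalSpace N] [ChartedSpace F N]

lemma complexValue_one_tmul {F : Type*} [NormedAddCommGroup F] [NormedSpace ℝ F] {N : Type*}
    (c₁ c₂ : TensorField F N) (q : N) (α β : Dual ℝ F) :
    complexValue c₁ c₂ q (1 ⊗ₜ α) (1 ⊗ₜ β) = (c₁ q α β : ℂ) + Complex.I * (c₂ q α β : ℂ) := by
  rw [complexValue, LinearMap.add_apply, LinearMap.add_apply, LinearMap.smul_apply,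
    LinearMap.smul_apply, baseChange_one_tmul, baseChange_one_tmul]
  rfl

lemma bddAbove_formRank (c : TensorField F N) :
    BddAbove (Set.range fun q => formRank (c q)) := by
  refine ⟨finrank ℝ (Dual ℝ F), ?_⟩
  rintro _ ⟨q, rfl⟩
  exact LinearMap.finrank_range_le (c q)

lemma fieldRank_le_maxRank {J : Submodule ℝ (TensorField F N)} {c : TensorField F N}
    (hc : c ∈ J) : fieldRank c ≤ maxRank J := by
  refine le_ciSup (f := fun c : J => fieldRank (c : TensorField F N))
    ⟨finrank ℝ (Dual ℝ F), ?_⟩ ⟨c, hc⟩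
  rintro _ ⟨d, rfl⟩
  exact ciSup_le' fun q => LinearMap.finrank_range_le _

lemma formRank_eq_maxRank {J : Submodule ℝ (TensorField F N)} {q : N} (hq : CompleteAt J q)
    {c : TensorField F N} (hc : c ∈ J) (hc0 : c ≠ 0) : formRank (c q) = maxRank J := by
  have h := hq c hc 0 J.zero_mem (Or.inl hc0)
  have h1 : complexValue c 0 q = (c q).baseChange ℂ := by
    refine bilinForm_ext_complexification fun α β => ?_
    rw [complexValue_one_tmul, baseChange_one_tmul]
    simp
  rwa [h1, formRank_baseChange] at h

lemma fieldRank_eq_maxRank {J : Submodule ℝ (TensorField F N)} {q : N} (hq : CompleteAt J q)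
    {c : TensorField F N} (hc : c ∈ J) (hc0 : c ≠ 0) : fieldRank c = maxRank J := by
  refine le_antisymm (fieldRank_le_maxRank hc) ?_
  rw [← formRank_eq_maxRank hq hc hc0]
  exact le_ciSup (bddAbove_formRank c) q

lemma mem_dualAnnihilator_bilagrangianTangent [IsManifold 𝓘(ℝ, F) ∞ N]
    {J : Submodule ℝ (TensorField F N)} {c : TensorField F N} (hc : c ∈ J)
    (hpoisson : IsPoisson c) (hmax : fieldRank c = maxRank J) {x : N}
    (hrank : ∀ᶠ q in 𝓝 x, formRank (c q) = formRank (c x)) {ξ : Dual ℝ F} (hξ : c x ξ = 0) :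
    ξ ∈ (bilagrangianTangent J x).dualAnnihilator := by
  obtain ⟨U, hU, hxU, f, hf, rfl⟩ := exists_casimir hpoisson hrank ξ hξ
  exact (Submodule.mem_dualAnnihilator _).2 fun v hv =>
    hv U hU hxU f (Submodule.subset_span ⟨c, hc, hmax, hf⟩)

lemma differential_add {f g : N → ℝ} {x : N} (hf : MDifferentiableAt 𝓘(ℝ, F) 𝓘(ℝ, ℝ) f x)
    (hg : MDifferentiableAt 𝓘(ℝ, F) 𝓘(ℝ, ℝ) g x) :
    differential (F := F) (f + g) x = differential f x + differential g x :=
  congrArg (fun L : F →L[ℝ] ℝ => L.toLinearMap) (mfderiv_add hf hg)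

lemma differential_const_smul {f : N → ℝ} {x : N} (r : ℝ)
    (hf : MDifferentiableAt 𝓘(ℝ, F) 𝓘(ℝ, ℝ) f x) :
    differential (F := F) (r • f) x = r • differential f x :=
  congrArg (fun L : F →L[ℝ] ℝ => L.toLinearMap) (const_smul_mfderiv hf r)

/-- By finite-dimensional duality it suffices that differentials of first integrals lie in `S`. The
induction over the span carries differentiability along, since the differential is additive only on
differentiable functions. -/
lemma dualAnnihilator_bilagrangianTangent_le {J : Submodule ℝ (TensorField F N)} {x : N}
    (S : Submodule ℝ (Dual ℝ F))
    (hS : ∀ c ∈ J, fieldRank c = maxRank J → LinearMap.ker (c x) ≤ S) :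
    (bilagrangianTangent J x).dualAnnihilator ≤ S := by
  have hle : S.dualCoannihilator ≤ bilagrangianTangent J x := by
    intro v hv U hU hxU f hf
    have h : MDifferentiableAt 𝓘(ℝ, F) 𝓘(ℝ, ℝ) f x ∧ differential f x ∈ S := by
      refine Submodule.span_induction ?_ ?_ ?_ ?_ hf
      · rintro f ⟨c, hc, hmax, hsm, hcas⟩
        exact ⟨((hsm x hxU).contMDiffAt (hU.mem_nhds hxU)).mdifferentiableAt (by simp),
          hS c hc hmax (hcas x hxU)⟩
      · have h0 : MDifferentiableAt 𝓘(ℝ, F) 𝓘(ℝ, ℝ) (0 : N → ℝ) x := mdifferentiableAt_const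
        refine ⟨h0, ?_⟩
        have := differential_const_smul (F := F) 0 h0
        rw [zero_smul, zero_smul] at this
        rw [this]
        exact S.zero_mem
      · rintro f g _ _ ⟨hf, hf'⟩ ⟨hg, hg'⟩
        refine ⟨hf.add hg, ?_⟩
        rw [differential_add hf hg]
        exact S.add_mem hf' hg'
      · rintro r f _ ⟨hf, hf'⟩
        refine ⟨hf.const_smul r, ?_⟩
        rw [differential_const_smul r hf]
        exact S.smul_mem r hf'
    exact (Submodule.mem_dualCoannihilator v).1 hv _ h.2
  have := Submodule.dualAnnihilator_anti hle
  rwa [Subspace.dualCoannihilator_dualAnnihilator_eq] at this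

lemma complexValue_combination (c₁ c₂ : TensorField F N) (x y : ℂ) (q : N) :
    complexValue (x.re • c₁ + y.re • c₂) (x.im • c₁ + y.im • c₂) q =
      x • (c₁ q).baseChange ℂ + y • (c₂ q).baseChange ℂ :=
  baseChange_combination x.re y.re x.im y.im (c₁ q) (c₂ q)

lemma eq_zero_of_smul_add_smul_eq_zero {V : Type*} [AddCommMonoid V] [Module ℝ V]
    {J : Submodule ℝ V} {c₁ c₂ : V} (hspan : J = Submodule.span ℝ {c₁, c₂})
    (hdim : finrank ℝ J = 2) (s t : ℝ) (h : s • c₁ + t • c₂ = 0) : s = 0 ∧ t = 0 := by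
  let _ : AddCommGroup V := Module.addCommMonoidToAddCommGroup ℝ
  have hind : LinearIndependent ℝ ![c₁, c₂] := by
    rw [linearIndependent_iff_card_eq_finrank_span, Fintype.card_fin, Set.finrank,
      Matrix.range_cons_cons_empty, ← hspan, hdim]
  exact LinearIndependent.pair_iff.1 hind s t h

/-- A family of complex bilinear forms on a complexification is continuous as soon as its values
on real vectors are. -/
lemma continuousOn_bilinForm_complexification {W Z : Type*} [AddCommGroup W] [Module ℝ W]
    [TopologicalSpace Z] {B : Z → LinearMap.BilinForm ℂ (ℂ ⊗[ℝ] W)} {S : Set Z}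
    (h : ∀ α β : W, ContinuousOn (fun z => B z (1 ⊗ₜ α) (1 ⊗ₜ β)) S) (u v : ℂ ⊗[ℝ] W) :
    ContinuousOn (fun z => B z u v) S := by
  obtain ⟨α, β, rfl⟩ := exists_eq_one_tmul_add u
  obtain ⟨α', β', rfl⟩ := exists_eq_one_tmul_add v
  have key : ∀ z, B z (1 ⊗ₜ α + Complex.I • 1 ⊗ₜ β) (1 ⊗ₜ α' + Complex.I • 1 ⊗ₜ β') =
      (B z (1 ⊗ₜ α) (1 ⊗ₜ α') + Complex.I * B z (1 ⊗ₜ α) (1 ⊗ₜ β')) +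
      Complex.I * (B z (1 ⊗ₜ β) (1 ⊗ₜ α') + Complex.I * B z (1 ⊗ₜ β) (1 ⊗ₜ β')) := by
    intro z
    rw [map_add, map_smul, map_add, map_smul, LinearMap.add_apply, LinearMap.smul_apply,
      LinearMap.add_apply, LinearMap.smul_apply, smul_eq_mul, smul_eq_mul, smul_eq_mul]
    ring
  refine ContinuousOn.congr ?_ fun z _ => key z
  exact ((h α α').add (continuousOn_const.mul (h α β'))).add
    (continuousOn_const.mul ((h β α').add (continuousOn_const.mul (h β β'))))

lemma hasConstantRank_of_completeAt {J : Submodule ℝ (TensorField F N)}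
    {c₁ c₂ : TensorField F N} (hspan : J = Submodule.span ℝ {c₁, c₂}) (hdim : finrank ℝ J = 2)
    {x : N} (hx : CompleteAt J x) :
    HasConstantRank ((c₁ x).baseChange ℂ) ((c₂ x).baseChange ℂ) (maxRank J) := by
  intro s t hst
  have hmem (a b : ℝ) : a • c₁ + b • c₂ ∈ J := by
    rw [hspan]
    exact Submodule.mem_span_pair.2 ⟨a, b, rfl⟩
  have h := hx _ (hmem s.re t.re) _ (hmem s.im t.im) (by
    by_contra! hcon
    have h1 := eq_zero_of_smul_add_smul_eq_zero hspan hdim s.re t.re hcon.1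
    have h2 := eq_zero_of_smul_add_smul_eq_zero hspan hdim s.im t.im hcon.2
    exact hst.elim (fun h => h (Complex.ext h1.1 h2.1)) (fun h => h (Complex.ext h1.2 h2.2)))
  rwa [complexValue_combination] at h

/-- The differential of a Casimir function of a real member lies in the kernel of that member, and
the core contains the kernels of all nonzero members of the pencil. -/
lemma baseChange_dualAnnihilator_le_pencilCore {J : Submodule ℝ (TensorField F N)}
    {c₁ c₂ : TensorField F N} (hspan : J = Submodule.span ℝ {c₁, c₂}) {x : N}
    (hR : HasConstantRank ((c₁ x).baseChange ℂ) ((c₂ x).baseChange ℂ) (maxRank J)) :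
    (bilagrangianTangent J x).dualAnnihilator.baseChange ℂ ≤
      pencilCore ((c₁ x).baseChange ℂ) ((c₂ x).baseChange ℂ) := by
  let S : Submodule ℝ (Dual ℝ F) :=
    ((pencilCore ((c₁ x).baseChange ℂ) ((c₂ x).baseChange ℂ)).restrictScalars ℝ).comap
      (TensorProduct.mk ℝ ℂ (Dual ℝ F) 1)
  have hle : (bilagrangianTangent J x).dualAnnihilator ≤ S := by
    refine dualAnnihilator_bilagrangianTangent_le S fun c hc hmax ξ hξ => ?_
    rw [hspan] at hc
    obtain ⟨s, t, rfl⟩ := Submodule.mem_span_pair.1 hc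
    change (1 : ℂ) ⊗ₜ[ℝ] ξ ∈ pencilCore ((c₁ x).baseChange ℂ) ((c₂ x).baseChange ℂ)
    have hmem : (1 : ℂ) ⊗ₜ[ℝ] ξ ∈ LinearMap.ker
        ((s : ℂ) • (c₁ x).baseChange ℂ + (t : ℂ) • (c₂ x).baseChange ℂ) := by
      refine (one_tmul_mem_ker_iff _ ξ).2 fun β => ?_
      have h1 : s * c₁ x ξ β + t * c₂ x ξ β = 0 := LinearMap.congr_fun hξ β
      simp only [LinearMap.add_apply, LinearMap.smul_apply, baseChange_one_tmul, smul_eq_mul]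
      exact_mod_cast h1
    by_cases hst : (s : ℂ) ≠ 0 ∨ (t : ℂ) ≠ 0
    · exact hR.ker_le_pencilCore _ _ hst hmem
    -- The zero bivector can have maximal rank only if R₀ = 0. Then the pencil vanishes at x and the
    -- core is everything.
    · have hst' : s = 0 ∧ t = 0 := by simpa using hst
      have h0 : maxRank J = 0 := by
        rw [← hmax, hst'.1, hst'.2, zero_smul, zero_smul, add_zero]
        refine Nat.le_zero.1 (ciSup_le' fun q => ?_)
        change finrank ℝ (LinearMap.range (0 : Dual ℝ F →ₗ[ℝ] Dual ℝ (Dual ℝ F))) ≤ 0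
        rw [LinearMap.range_zero, finrank_bot]
      have h1 := hR 1 0 (by simp)
      rw [h0, formRank, Submodule.finrank_eq_zero, LinearMap.range_eq_bot] at h1
      refine hR.ker_le_pencilCore 1 0 (by simp) ?_
      rw [h1, LinearMap.ker_zero]
      trivial
  rw [Submodule.baseChange_eq_span, Submodule.span_le]
  rintro _ ⟨ξ, hξ, rfl⟩
  exact hle hξ

/-- The core uses real parameters only, so its generating kernels are complexifications of kernels
of real members. Completeness near x makes their ranks locally constant, and each real kernel
covector integrates to a Casimir function. -/
lemma pencilCore_le_baseChange_dualAnnihilator [IsManifold 𝓘(ℝ, F) ∞ N]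
    {J : Submodule ℝ (TensorField F N)} (hJ : IsBihamiltonian J) {c₁ c₂ : TensorField F N}
    (hspan : J = Submodule.span ℝ {c₁, c₂}) (hdim : finrank ℝ J = 2) {x : N}
    (hx : x ∈ completeLocus J) :
    pencilCore ((c₁ x).baseChange ℂ) ((c₂ x).baseChange ℂ) ≤
      (bilagrangianTangent J x).dualAnnihilator.baseChange ℂ := by
  have hxc : CompleteAt J x := interior_subset hx
  have hnhds : ∀ᶠ q in 𝓝 x, CompleteAt J q := mem_interior_iff_mem_nhds.1 hx
  refine iSup₂_le fun t ht => ?_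
  obtain ⟨-, r, rfl⟩ := ht
  rw [← baseChange_add_smul, ker_baseChange_complex]
  have hc : (1 : ℝ) • c₁ + r • c₂ ∈ J := by
    rw [hspan]
    exact Submodule.mem_span_pair.2 ⟨1, r, rfl⟩
  have hne : (1 : ℝ) • c₁ + r • c₂ ≠ 0 := fun h =>
    one_ne_zero (eq_zero_of_smul_add_smul_eq_zero hspan hdim 1 r h).1
  rw [one_smul] at hc hne
  refine Submodule.baseChange_mono ℂ fun ξ hξ => ?_
  refine mem_dualAnnihilator_bilagrangianTangent hc (hJ.poisson _ hc)
    (fieldRank_eq_maxRank hxc hc hne) ?_ (LinearMap.mem_ker.1 hξ)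
  filter_upwards [hnhds] with q hq
  rw [formRank_eq_maxRank hq hc hne, formRank_eq_maxRank hxc hc hne]

/-- The complexified annihilator of the bilagrangian foliation of a complete bihamiltonian
structure is lagrangian with respect to the complex Poisson bivector. -/
theorem mem_baseChange_dualAnnihilator_bilagrangianTangent_iff [IsManifold 𝓘(ℝ, F) ∞ N]
    {J : Submodule ℝ (TensorField F N)} (hJ : IsBihamiltonian J) {c₁ c₂ : TensorField F N}
    (hspan : J = Submodule.span ℝ {c₁, c₂}) {x : N} (hx : x ∈ completeLocus J)
    (u : ℂ ⊗[ℝ] Dual ℝ F) :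
    u ∈ (bilagrangianTangent J x).dualAnnihilator.baseChange ℂ ↔
      ∀ w ∈ (bilagrangianTangent J x).dualAnnihilator.baseChange ℂ,
        complexValue c₁ c₂ x w u = 0 := by
  have hc₁ : c₁ ∈ J := hspan ▸ Submodule.subset_span (by simp)
  have hc₂ : c₂ ∈ J := hspan ▸ Submodule.subset_span (by simp)
  have hxc : CompleteAt J x := interior_subset hx
  have hval : complexValue c₁ c₂ x = (1 : ℂ) • (c₁ x).baseChange ℂ +
      Complex.I • (c₂ x).baseChange ℂ := by
    rw [one_smul]
    rfl
  rcases hJ.dim with hdim | hbot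
  · have hR := hasConstantRank_of_completeAt hspan hdim hxc
    have hcore := (baseChange_dualAnnihilator_le_pencilCore hspan hR).antisymm
      (pencilCore_le_baseChange_dualAnnihilator hJ hspan hdim hx)
    rw [hcore, hval]
    exact hR.mem_pencilCore_iff (isAlt_baseChange ((hJ.poisson c₁ hc₁).alternating x))
      (isAlt_baseChange ((hJ.poisson c₂ hc₂).alternating x)) 1 Complex.I (by simp) u
  · have h₁ : c₁ = 0 := by rwa [hbot, Submodule.mem_bot] at hc₁
    have h₂ : c₂ = 0 := by rwa [hbot, Submodule.mem_bot] at hc₂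
    -- For the trivial structure every smooth function is a Casimir function of 0, so ℒ' is the
    -- foliation by points and both sides of the equivalence always hold.
    have htop : (bilagrangianTangent J x).dualAnnihilator = ⊤ := by
      refine eq_top_iff.2 fun ξ _ => ?_
      have hmax : fieldRank (0 : TensorField F N) = maxRank J := by
        refine le_antisymm (fieldRank_le_maxRank J.zero_mem) (ciSup_le' fun c => ?_)
        have hc : (c : TensorField F N) = 0 := (Submodule.mem_bot ℝ).1 (hbot.le c.2)
        rw [hc]
      exact mem_dualAnnihilator_bilagrangianTangent J.zero_mem (hJ.poisson _ J.zero_mem) hmax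
        (Eventually.of_forall fun q => rfl) rfl
    have hzero : complexValue c₁ c₂ x = 0 := by
      refine bilinForm_ext_complexification fun α β => ?_
      rw [h₁, h₂, complexValue_one_tmul]
      simp
    rw [htop, Submodule.baseChange_top, hzero]
    simp

/-- A bound for the rank of a complex Poisson bivector that holds on a dense set holds
everywhere. -/
lemma formRank_complexValue_le_of_dense [IsManifold 𝓘(ℝ, F) ∞ N] {c₁ c₂ : TensorField F N}
    (h₁ : IsPoisson c₁) (h₂ : IsPoisson c₂) {U : Set N} (hU : Dense U) {R : ℕ}
    (hR : ∀ q ∈ U, formRank (complexValue c₁ c₂ q) ≤ R) (x : N) :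
    formRank (complexValue c₁ c₂ x) ≤ R := by
  let g : N → ℂ ⊗[ℝ] Dual ℝ F →ₗ[ℂ] ℂ ⊗[ℝ] Dual ℝ F := fun q =>
    (chartDifferential F x q).toLinearMap.dualMap.baseChange ℂ
  let B : N → LinearMap.BilinForm ℂ (ℂ ⊗[ℝ] Dual ℝ F) := fun q =>
    (complexValue c₁ c₂ q).compl₁₂ (g q) (g q)
  have hrank (q : N) (hq : q ∈ (chartAt F x).source) :
      formRank (B q) = formRank (complexValue c₁ c₂ q) :=
    formRank_compl₁₂ _ (LinearMap.baseChange_surjective ℂ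
      (dualMap_chartDifferential_surjective hq))
  have hreal (c : TensorField F N) (hc : IsPoisson c) (α β : Dual ℝ F) :
      ContinuousOn (bracket c (fun y => α (chartAt F x y)) (fun y => β (chartAt F x y)))
        (chartAt F x).source :=
    (hc.smooth _ (chartAt F x).open_source _ _ (smoothOn_coordinate x α)
      (smoothOn_coordinate x β)).continuousOn
  have hone (α β : Dual ℝ F) :
      ContinuousOn (fun q => B q (1 ⊗ₜ α) (1 ⊗ₜ β)) (chartAt F x).source := by
    have h : ContinuousOn (fun q =>
        (bracket c₁ (fun y => α (chartAt F x y)) (fun y => β (chartAt F x y)) q : ℂ) +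
        Complex.I * (bracket c₂ (fun y => α (chartAt F x y)) (fun y => β (chartAt F x y)) q : ℂ))
        (chartAt F x).source :=
      (Complex.continuous_ofReal.comp_continuousOn (hreal c₁ h₁ α β)).add
        (continuousOn_const.mul (Complex.continuous_ofReal.comp_continuousOn (hreal c₂ h₂ α β)))
    refine h.congr fun q hq => ?_
    have hg (γ : Dual ℝ F) : g q (1 ⊗ₜ γ) =
        1 ⊗ₜ differential (F := F) (fun y => γ (chartAt F x y)) q := by
      rw [differential_coordinate hq]
      rfl
    exact (congrArg₂ (fun u v => complexValue c₁ c₂ q u v) (hg α) (hg β)).trans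
      (complexValue_one_tmul c₁ c₂ q _ _)
  -- The points whose rank is at least the rank at x contain a neighbourhood of x, which meets the
  -- dense set where the bound is known.
  have hopen := isOpen_le_formRank (chartAt F x).open_source B
    (continuousOn_bilinForm_complexification hone)
    (formRank (complexValue c₁ c₂ x))
  have hx : x ∈ (chartAt F x).source := mem_chart_source F x
  obtain ⟨q, ⟨hq, hq'⟩, hqU⟩ := hU.inter_open_nonempty _ hopen ⟨x, hx, (hrank x hx).ge⟩
  rw [Set.mem_ofPred_eq, hrank q hq] at hq'
  exact hq'.trans (hR q hqU)

end CompleteStructures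

end CRBihamiltonian

end

/-! ### Minimal realizations and CR-lagrangian foliations -/

theorem mainTheorem10
    {E : Type*} [NormedAddCommGroup E] [NormedSpace ℂ E] [FiniteDimensional ℂ E]
    {M : Type*} [TopologicalSpace M] [ChartedSpace E M] [IsManifold 𝓘(ℂ, E) ω M]
    {E' : Type*} [NormedAddCommGroup E'] [NormedSpace ℝ E'] [FiniteDimensional ℝ E']
    {M' : Type*} [TopologicalSpace M'] [ChartedSpace E' M'] [IsManifold 𝓘(ℝ, E') ∞ M']
    (Ω : HolomorphicSymplecticForm E M) (p : M → M')
    (J' : Submodule ℝ (TensorField E' M'))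
    (hJ' : IsBihamiltonian J') (hcomplete : IsCompleteBihamiltonian J')
    (hrealization : IsRealization Ω p J')
    (hgeneric : IsGenericCRFibration E E' p) :
    IsMinimal E' Ω p ↔
      IsCRLagrangianOn Ω (p ⁻¹' completeLocus J')
        (pullbackTangent p (bilagrangianTangent J')) := by
  obtain ⟨hfib, c₁, c₂, h₁, h₂, hspan⟩ := hrealization
  have hc₁ : c₁ ∈ J' := hspan ▸ Submodule.subset_span (by simp)
  have hc₂ : c₂ ∈ J' := hspan ▸ Submodule.subset_span (by simp)
  constructor
  · intro hmin x hx
    have hcoiso := (crSubspace_fibreTangent_isotropic_iff Ω p x).1 (hmin x (Set.mem_univ x))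
    rw [pullbackTangent, crSubspace_comap Ω]
    -- Here T^{1,0}ℒ is f(Φ)^⊥, and f(Φ) is lagrangian, so the inner and the outer complement both
    -- collapse to f(Φ).
    rw [orthogonal_map_eq (Ω.nondegenerate x) (isAlt_toBilin _) _ hcoiso _ fun u => ?_,
      orthogonal_map_eq (Ω.nondegenerate x) (isAlt_toBilin _) _ hcoiso _ fun u => ?_]
    all_goals
      rw [mem_baseChange_dualAnnihilator_bilagrangianTangent_iff hJ' hspan hx,
        ← toBilin_complexLift_eq_complexValue Ω p x h₁ h₂]
      rfl
  · intro hlag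
    have hdense : Dense (completeLocus J') := by
      obtain ⟨U, hU, hUd, hUc⟩ := hcomplete
      exact hUd.mono (interior_maximal hUc hU)
    have hiff (x : M) := crSubspace_fibreTangent_isotropic_iff_rank Ω p x (hfib.submersion x)
      (hgeneric.generic x) h₁ h₂
    have hlocus (x : M) (hx : p x ∈ completeLocus J') :
        crSubspace (fibreTangent E E' p x) ≤
          (toBilin (Ω.toFun x)).orthogonal (crSubspace (fibreTangent E E' p x)) := by
      -- The fibres lie in the leaves of ℒ, and a subspace of a lagrangian space is isotropic.
      have hle : crSubspace (fibreTangent E E' p x) ≤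
          crSubspace (pullbackTangent p (bilagrangianTangent J') x) := by
        intro v hv
        rw [mem_crSubspace_iff] at hv ⊢
        have hsub : fibreTangent E E' p x ≤ pullbackTangent p (bilagrangianTangent J') x :=
          Submodule.comap_mono bot_le
        exact ⟨hsub hv.1, hsub hv.2⟩
      refine hle.trans ?_
      rw [← hlag x hx]
      exact LinearMap.BilinForm.orthogonal_le hle
    intro x _
    rw [hiff]
    have hrank : ∀ q ∈ completeLocus J', formRank (complexValue c₁ c₂ q) ≤
        2 * Module.finrank ℝ E' - Module.finrank ℂ E := by
      intro q hq
      obtain ⟨y, hy⟩ := (hfib.connected q).nonempty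
      have hy' : p y = q := hy
      subst hy'
      have := (hiff y).1 (hlocus y hq)
      omega
    -- This keeps the natural-number subtraction in `hrank` from truncating. It is read off at any
    -- point over the locus; one exists by density, since `M'` contains `p x`.
    have hdim : Module.finrank ℂ E ≤ 2 * Module.finrank ℝ E' := by
      obtain ⟨q, hq⟩ := hdense.nonempty_iff.2 ⟨p x⟩
      obtain ⟨y, hy⟩ := (hfib.connected q).nonempty
      have hy' : p y = q := hy
      subst hy'
      have := (hiff y).1 (hlocus y hq)
      omega
    have := formRank_complexValue_le_of_dense (hJ'.poisson c₁ hc₁) (hJ'.poisson c₂ hc₂) hdense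
      hrank (p x)
    omega
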